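/- Let $m\ge 3$ be an integer such that $F=\mathbb{Q}(\zeta_m)$ has class number $1$, let $F_0$ be its maximal totally real subfield, let $n=[F_0:\mathbb{Q}]$, and let $\Phi$ be a CM-type of $F$, i.e. a set of $n$ distinct embeddings $F\hookrightarrow\mathbb{C}$, no two of which are complex conjugate. Call $\Phi$ simple if it is not induced from a CM-type of a proper CM-subfield of $F$. A complex abelian variety $A$ is said to be of type $(\mathcal{O}_F,\Phi)$ if there is an embedding $\iota:F\hookrightarrow \mathrm{End}(A)\otimes\mathbb{Q}$ with $\iota^{-1}(\mathrm{End}(A))=\mathcal{O}_F$ such that the representation of $F$ on $\mathrm{Lie}(A)$ is isomorphic to $\bigoplus_{\phi\in\Phi}\phi$ (so that $\dim A=n$). The narrow class number of $F_0$ is the order of the group of nonzero fractional ideals of $F_0$ modulo the principal ideals generated by a totally positive element. 1. If $F_0$ has narrow class number $1$, then there exists a principally polarized abelian variety of type $(\mathcal{O}_F,\Phi)$. If moreover $\Phi$ is simple, then it is unique up to isomorphism of principally polarized abelian varieties. 2. If $F_0$ has narrow class number $2$ and $\Phi$ is simple, then any two principally polarized abelian varieties of type $(\mathcal{O}_F,\Phi)$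 are isomorphic as principally polarized abelian varieties; that is, if one exists, it is unique up to isomorphism. -/

import Mathlib

open NumberField
open scoped nonZeroDivisors

noncomputable section

namespace CMAbelian

/-! ### The narrow class group -/

/-- The totally positive elements of `K`: the nonzero elements which are positive under every
real embedding of `K`. -/
def totallyPositive (K : Type*) [Field K] : Subgroup Kˣ where
  carrier := {a | ∀ τ : K →+* ℝ, 0 < τ (a : K)}
  one_mem' := by
    intro τ
    simp
  mul_mem' := by
    intro a b ha hb τ
    simpa using mul_pos (ha τ) (hb τ)
  inv_mem' := by
    intro a ha τ
    simpa using ha τ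

/-- The narrow class group of `K`: nonzero fractional ideals modulo the principal ones that are
generated by a totally positive element. -/
abbrev NarrowClassGroup (K : Type*) [Field K] [NumberField K] : Type _ :=
  (FractionalIdeal (𝓞 K)⁰ K)ˣ ⧸ (totallyPositive K).map (toPrincipalIdeal (𝓞 K) K)

/-- The narrow class number of `K`. -/
def narrowClassNumber (K : Type*) [Field K] [NumberField K] : ℕ :=
  Nat.card (NarrowClassGroup K)

/-! ### CM-types -/

/-- A CM-type of a CM-field `L`: a set of `n` distinct embeddings `L → ℂ`, no two of which are
complex conjugate, where `n` is the degree over `ℚ` of the maximal totally real subfield. -/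
structure CMType (L : Type*) [Field L] [NumberField L] where
  /-- the embeddings that belong to the CM-type -/
  embeddings : Finset (L →+* ℂ)
  card_eq : embeddings.card = Module.finrank ℚ (maximalRealSubfield L)
  conjugate_notMem : ∀ φ ∈ embeddings, ComplexEmbedding.conjugate φ ∉ embeddings

namespace CMType

variable {L : Type*} [Field L] [NumberField L]

/-- `Φ` is induced from the CM-type `Ψ` of the subfield `K`: it consists of all the embeddings
of `L` whose restriction to `K` lies in `Ψ`. -/
def IsInducedFrom (Φ : CMType L) (K : IntermediateField ℚ L) (Ψ : CMType K) : Prop :=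
  ∀ φ : L →+* ℂ, φ ∈ Φ.embeddings ↔ φ.comp (algebraMap K L) ∈ Ψ.embeddings

/-- `Φ` is simple: it is not induced from a CM-type of a proper CM-subfield. -/
def IsSimple (Φ : CMType L) : Prop :=
  ∀ K : IntermediateField ℚ L, K ≠ ⊤ → IsCMField K → ∀ Ψ : CMType K, ¬ Φ.IsInducedFrom K Ψ

end CMType

/-! ### Complex tori and principal polarizations -/

/-- A complex torus `ℂ^g / Λ`, with `Λ` a lattice (a discrete subgroup which spans `ℂ^g`
over `ℝ`). -/
structure ComplexTorus where
  /-- the dimension `g` -/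
  dim : ℕ
  /-- the lattice `Λ` -/
  lattice : Submodule ℤ (Fin dim → ℂ)
  [discrete : DiscreteTopology lattice]
  [isZLattice : IsZLattice ℝ lattice]

namespace ComplexTorus

/-- The universal cover `ℂ^g` of the torus, which is also its Lie algebra. -/
abbrev Lie (A : ComplexTorus) : Type := Fin A.dim → ℂ

/-- The endomorphism ring of `ℂ^g / Λ`: the `ℂ`-linear endomorphisms of `ℂ^g` that map `Λ` into
itself. -/
def endRing (A : ComplexTorus) : Subring (Module.End ℂ A.Lie) where
  carrier := {f | ∀ v ∈ A.lattice, f v ∈ A.lattice}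
  one_mem' := fun _ hv => hv
  mul_mem' := fun hf hg v hv => hf _ (hg v hv)
  zero_mem' := fun _ _ => A.lattice.zero_mem
  add_mem' := fun hf hg v hv => A.lattice.add_mem (hf v hv) (hg v hv)
  neg_mem' := fun hf v hv => A.lattice.neg_mem (hf v hv)

/-- `E` is (the Riemann form of) a principal polarization of `ℂ^g / Λ`: a real-valued alternating
`ℝ`-bilinear form, integral on `Λ`, with `E(iv, iw) = E(v, w)` and `E(iv, v) > 0` for `v ≠ 0`,
for which `Λ` is self-dual. -/
structure IsPrincipalPolarization (A : ComplexTorus) (E : A.Lie →ₗ[ℝ] A.Lie →ₗ[ℝ] ℝ) : Prop where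
  alternating : ∀ v, E v v = 0
  map_I_smul : ∀ v w, E (Complex.I • v) (Complex.I • w) = E v w
  pos : ∀ v, v ≠ 0 → 0 < E (Complex.I • v) v
  integral : ∀ v ∈ A.lattice, ∀ w ∈ A.lattice, ∃ k : ℤ, E v w = k
  selfDual : ∀ f : A.lattice →+ ℤ, ∃ w ∈ A.lattice, ∀ v : A.lattice, E v w = f v

end ComplexTorus

/-- A principally polarized complex abelian variety: a complex torus with a principal
polarization. -/
structure PPAV extends ComplexTorus where
  /-- the Riemann form of the polarization -/
  form : toComplexTorus.Lie →ₗ[ℝ] toComplexTorus.Lie →ₗ[ℝ] ℝ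
  isPrincipalPolarization : toComplexTorus.IsPrincipalPolarization form

/-- Two principally polarized abelian varieties are isomorphic: there is an isomorphism of the
complex tori (a `ℂ`-linear isomorphism of the universal covers which maps one lattice onto the
other) under which the polarizations correspond. -/
def PPAV.IsIsomorphic (A B : PPAV) : Prop :=
  ∃ f : A.Lie ≃ₗ[ℂ] B.Lie,
    (∀ v, f v ∈ B.lattice ↔ v ∈ A.lattice) ∧ ∀ v w, B.form (f v) (f w) = A.form v w

/-- The torus `A` has type `(𝓞_L, Φ)`: there is an embedding `ι` of `L` into
`End(A) ⊗ ℚ ⊆ End_ℂ(Lie A)` such that the elements of `L` which act as endomorphisms of `A` are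
exactly those of `𝓞_L`, and such that the representation of `L` on `Lie A` is isomorphic to the
direct sum of the `φ ∈ Φ` (in particular `dim A = n`). Every element of `L` has a nonzero integer
multiple in `𝓞_L`, so the first condition puts the image of `ι` into `End(A) ⊗ ℚ`. -/
def ComplexTorus.HasType {L : Type*} [Field L] [NumberField L] (A : ComplexTorus)
    (Φ : CMType L) : Prop :=
  ∃ ι : L →+* Module.End ℂ A.Lie,
    (∀ x : L, ι x ∈ A.endRing ↔ IsIntegral ℤ x) ∧
    ∃ e : A.Lie ≃ₗ[ℂ] (Φ.embeddings → ℂ),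
      ∀ (x : L) (v : A.Lie) (φ : Φ.embeddings), e (ι x v) φ = (φ : L →+* ℂ) x * e v φ

end CMAbelian

end

/-! Class number one makes the lattice of a variety of type (𝓞 F, Φ) free of rank one over 𝓞 F, so
after rescaling coordinates the torus is ℂ^Φ/Φ(𝓞 F). If Φ is simple, each Riemann form on it is E(x,
y) = Tr(ξ x ȳ) for some ξ in F (`IsSimple.exists_form_eq`): writing E(x, y) = Tr(x T(y)) with T = Σ
c_σ σ, invariance under i forces c_σ = 0 unless σ followed by complex conjugation stabilizes Φ, and
simplicity leaves only σ = conjugation. The form is a principal polarization exactly when φ(ξ) lies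
on the negative imaginary axis for all φ in Φ and ξ𝓞 F is the trace dual of 𝓞 F.

Two such ξ differ by a totally positive unit of F₀, and the varieties are isomorphic if this unit is
a norm uū. Let U be the units of F₀ and P its totally positive elements. The index of UP in F₀ˣ
divides the narrow class number, and Dirichlet's unit theorem bounds the number of totally positive
units modulo squares by this index (`relIndex_squares_ne_zero_and_le`). If the index is 1, totally
positive units are squares t² = t t̄, hence norms. Units then also have all signatures, and
existence follows by correcting the signs of a purely imaginary generator of the inverse different,
ζ^r/f'(ζ) with f the minimal polynomial of ζ.

If the index is 2, one norm that is not a square in U suffices. When m is not a prime power,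
(1-ζ)(1-ζ⁻¹) is one (`exists_nonsquare_norm`, for m odd or divisible by 4). When m is a prime power,
F₀ has a unit of norm -1, a quotient of sines, and Galois invariance of UP then rules out index 2
(`index_ne_two_of_norm_eq_neg_one`). -/

namespace CMAbelian

/-! ### CM-types and their stabilizers in the Galois group -/

namespace CMType

section CMField

variable {L : Type*} [Field L] [NumberField L]

theorem finrank_eq_two_mul [IsCMField L] :
    Module.finrank ℚ L = 2 * Module.finrank ℚ (maximalRealSubfield L) := by
  rw [← Module.finrank_mul_finrank ℚ (maximalRealSubfield L) L,
    Algebra.IsQuadraticExtension.finrank_eq_two (maximalRealSubfield L) L, mul_comm]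

theorem mem_or_conjugate_mem [IsCMField L] (Φ : CMType L) (φ : L →+* ℂ) :
    φ ∈ Φ.embeddings ∨ ComplexEmbedding.conjugate φ ∈ Φ.embeddings := by
  classical
  have hinj : Function.Injective (ComplexEmbedding.conjugate : (L →+* ℂ) → (L →+* ℂ)) :=
    star_injective
  have hd : Disjoint Φ.embeddings (Φ.embeddings.image ComplexEmbedding.conjugate) := by
    rw [Finset.disjoint_left]
    intro ψ hψ hψ'
    obtain ⟨χ, hχ, rfl⟩ := Finset.mem_image.1 hψ'
    exact Φ.conjugate_notMem χ hχ hψ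
  have hu : Φ.embeddings ∪ Φ.embeddings.image ComplexEmbedding.conjugate = Finset.univ := by
    apply Finset.eq_univ_of_card
    rw [Finset.card_union_of_disjoint hd, Finset.card_image_of_injective _ hinj, Φ.card_eq,
      Embeddings.card, finrank_eq_two_mul (L := L), two_mul]
  have := Finset.mem_univ φ
  rw [← hu, Finset.mem_union, Finset.mem_image] at this
  refine this.imp id ?_
  rintro ⟨ψ, hψ, rfl⟩
  simpa [star_star] using hψ

theorem conjugate_mem_iff [IsCMField L] (Φ : CMType L) (φ : L →+* ℂ) :
    ComplexEmbedding.conjugate φ ∈ Φ.embeddings ↔ φ ∉ Φ.embeddings :=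
  ⟨fun h h' => Φ.conjugate_notMem φ h' h, fun h => (Φ.mem_or_conjugate_mem φ).resolve_left h⟩

/-- A set of embeddings that contains exactly one member of each pair of complex conjugate
embeddings is a CM-type. -/
noncomputable def ofConjugateMemIff [IsCMField L] (S : Finset (L →+* ℂ))
    (h : ∀ φ, ComplexEmbedding.conjugate φ ∈ S ↔ φ ∉ S) : CMType L where
  embeddings := S
  card_eq := by
    classical
    have hinj : Function.Injective (ComplexEmbedding.conjugate : (L →+* ℂ) → (L →+* ℂ)) :=
      star_injective
    have hc : Sᶜ = S.image ComplexEmbedding.conjugate := by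
      ext φ
      rw [Finset.mem_compl, ← h, Finset.mem_image]
      constructor
      · intro hφ
        exact ⟨_, hφ, star_star φ⟩
      · rintro ⟨ψ, hψ, rfl⟩
        simpa using hψ
    have := S.card_add_card_compl
    rw [hc, Finset.card_image_of_injective _ hinj, Embeddings.card, finrank_eq_two_mul (L := L)] at this
    omega
  conjugate_notMem := fun φ hφ => fun h' => (h φ).1 h' hφ

end CMField

variable {F : Type*} [Field F] [NumberField F]

/-- Φ is induced from the fixed field K of its stabilizer H. This K is a CM-field, being abelian and
totally complex, so simplicity forces K = F and H = 1. -/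
theorem eq_one_of_forall_comp_mem [IsCMField F] [IsAbelianGalois ℚ F] {Φ : CMType F}
    (hΦ : Φ.IsSimple) (σ : Gal(F/ℚ))
    (hσ : ∀ φ ∈ Φ.embeddings, φ.comp (σ : F →+* F) ∈ Φ.embeddings) : σ = 1 := by
  classical
  let H : Subgroup Gal(F/ℚ) :=
    { carrier := {τ | ∀ φ, φ.comp (τ : F →+* F) ∈ Φ.embeddings ↔ φ ∈ Φ.embeddings}
      one_mem' := fun φ => Iff.rfl
      mul_mem' := by
        intro τ υ hτ hυ φ
        exact (hυ (φ.comp (τ : F →+* F))).trans (hτ φ)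
      inv_mem' := by
        intro τ hτ φ
        have h1 := hτ (φ.comp ((τ⁻¹ : Gal(F/ℚ)) : F →+* F))
        have h2 : (φ.comp ((τ⁻¹ : Gal(F/ℚ)) : F →+* F)).comp (τ : F →+* F) = φ := by
          ext x
          exact congrArg φ (τ.symm_apply_apply x)
        rw [h2] at h1
        exact h1.symm }
  have hσH : σ ∈ H := by
    have hinj : Function.Injective fun φ : F →+* ℂ => φ.comp (σ : F →+* F) := by
      intro φ ψ h
      ext x
      simpa using RingHom.congr_fun h (σ.symm x)
    have himg : Φ.embeddings.image (fun φ => φ.comp (σ : F →+* F)) = Φ.embeddings := by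
      apply Finset.eq_of_subset_of_card_le
      · intro ψ hψ
        obtain ⟨φ, hφ, rfl⟩ := Finset.mem_image.1 hψ
        exact hσ φ hφ
      · rw [Finset.card_image_of_injective _ hinj]
    intro φ
    refine ⟨fun h => ?_, hσ φ⟩
    rw [← himg] at h
    obtain ⟨ψ, hψ, hψφ⟩ := Finset.mem_image.1 h
    rwa [← hinj hψφ]
  let K : IntermediateField ℚ F := IntermediateField.fixedField H
  have hagree : ∀ φ ψ : F →+* ℂ, φ.comp (algebraMap K F) = ψ.comp (algebraMap K F) →
      (φ ∈ Φ.embeddings ↔ ψ ∈ Φ.embeddings) := by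
    intro φ ψ h
    obtain ⟨τ, hτ⟩ := NumberField.ComplexEmbedding.exists_comp_symm_eq_of_comp_eq φ ψ h
    have hτH : (τ.symm.restrictScalars ℚ : Gal(F/ℚ)) ∈ H := by
      rw [← IntermediateField.fixingSubgroup_fixedField H]
      rw [IntermediateField.mem_fixingSubgroup_iff]
      intro x hx
      exact τ.symm.commutes ⟨x, hx⟩
    rw [← hτ]
    exact (hτH φ).symm
  have hext : ∀ ψ : K →+* ℂ, ∃ φ : F →+* ℂ, φ.comp (algebraMap K F) = ψ := fun ψ =>
    ⟨_, ComplexEmbedding.lift_comp_algebraMap F ψ⟩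
  have hconj : ∀ φ : F →+* ℂ, (ComplexEmbedding.conjugate φ).comp (algebraMap K F) =
      ComplexEmbedding.conjugate (φ.comp (algebraMap K F)) := fun φ => rfl
  -- A real embedding of K would extend to some φ that agrees on K with its conjugate; then both or
  -- neither would lie in Φ.
  have : IsTotallyComplex K := by
    refine ⟨fun w => ?_⟩
    rw [← InfinitePlace.not_isReal_iff_isComplex]
    intro hw
    obtain ⟨φ, hφ⟩ := hext w.embedding
    rw [InfinitePlace.isReal_iff, ComplexEmbedding.isReal_iff, ← hφ, ← hconj] at hw
    have h1 := hagree _ _ hw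
    rw [conjugate_mem_iff] at h1
    tauto
  have : IsAbelianGalois ℚ K := IsAbelianGalois.tower_bot ℚ K F
  have hCM : IsCMField K := NumberField.IsCMField.of_isAbelianGalois K
  let S : Finset (K →+* ℂ) := Φ.embeddings.image fun φ => φ.comp (algebraMap K F)
  have hS : ∀ φ : F →+* ℂ, φ.comp (algebraMap K F) ∈ S ↔ φ ∈ Φ.embeddings := by
    intro φ
    refine ⟨fun h => ?_, fun h => Finset.mem_image_of_mem _ h⟩
    obtain ⟨ψ, hψ, hψφ⟩ := Finset.mem_image.1 h
    exact (hagree _ _ hψφ).1 hψ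
  by_contra hne
  refine hΦ K ?_ hCM (ofConjugateMemIff S ?_) fun φ => (hS φ).symm
  · intro htop
    have h1 := IntermediateField.fixingSubgroup_fixedField H
    rw [show IntermediateField.fixedField H = ⊤ from htop,
      IntermediateField.fixingSubgroup_top] at h1
    rw [← h1] at hσH
    exact hne (Subgroup.mem_bot.1 hσH)
  · intro ψ
    obtain ⟨φ, rfl⟩ := hext ψ
    rw [← hconj, hS, hS, conjugate_mem_iff]

end CMType

/-! ### The lattice as an 𝓞 F-module -/

namespace ComplexTorus

variable {F : Type*} [Field F] [NumberField F]

theorem finrank_lattice (A : ComplexTorus) : Module.finrank ℤ A.lattice = 2 * A.dim := by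
  have := A.discrete
  have := A.isZLattice
  rw [ZLattice.rank ℝ, ← Module.finrank_mul_finrank ℝ ℂ, Complex.finrank_real_complex,
    Module.finrank_fin_fun]

theorem HasType.dim_eq {A : ComplexTorus} {Φ : CMType F} (hA : A.HasType Φ) :
    A.dim = Module.finrank ℚ (maximalRealSubfield F) := by
  obtain ⟨ι, -, e, -⟩ := hA
  have := e.finrank_eq
  rwa [Module.finrank_fin_fun, Module.finrank_fintype_fun_eq_card, Fintype.card_coe,
    Φ.card_eq] at this

/-- If the class number is `1`, then the lattice of a torus of type `(𝓞_F, Φ)` is free of rank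
one over `𝓞_F`. -/
theorem HasType.exists_generator [IsCMField F] (hF : classNumber F = 1) {A : ComplexTorus}
    {Φ : CMType F} (hA : A.HasType Φ) (ι : F →+* Module.End ℂ A.Lie)
    (hι : ∀ x : F, ι x ∈ A.endRing ↔ IsIntegral ℤ x) :
    ∃ l ∈ A.lattice, ∀ v, v ∈ A.lattice ↔ ∃ x : 𝓞 F, v = ι x l := by
  have := A.discrete
  have := A.isZLattice
  have hmem : ∀ (x : 𝓞 F) (v), v ∈ A.lattice → ι x v ∈ A.lattice := fun x =>
    (hι x).2 x.isIntegral_coe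
  let : SMul (𝓞 F) A.lattice := ⟨fun x v => ⟨ι x v, hmem x v v.2⟩⟩
  have hsmul : ∀ (x : 𝓞 F) (v : A.lattice), ((x • v : A.lattice) : A.Lie) = ι x v :=
    fun _ _ => rfl
  let : Module (𝓞 F) A.lattice :=
    { one_smul := fun v => by ext1; simp [hsmul]
      mul_smul := fun x y v => by ext1; simp [hsmul]
      smul_zero := fun x => by ext1; simp [hsmul]
      zero_smul := fun v => by ext1; simp [hsmul]
      smul_add := fun x v w => by ext1; simp [hsmul]
      add_smul := fun x y v => by ext1; simp [hsmul] }
  have : Module.Finite ℤ A.lattice := ZLattice.module_finite ℝ A.lattice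
  have : Module.Finite (𝓞 F) A.lattice := Module.Finite.of_restrictScalars_finite ℤ _ _
  have : IsPrincipalIdealRing (𝓞 F) := (classNumber_eq_one_iff).1 hF
  -- A nonzero x acts invertibly, because its inverse in F acts on the Lie algebra.
  have : Module.IsTorsionFree (𝓞 F) A.lattice := by
    refine .of_smul_eq_zero fun x v h => ?_
    by_contra! hxv
    have h2 : ι x v = 0 := by rw [← hsmul, h]; rfl
    have h3 : ι ((x : F)⁻¹ * x) v = 0 := by
      rw [map_mul, Module.End.mul_apply, h2, map_zero]
    rw [inv_mul_cancel₀ (by exact_mod_cast hxv.1), map_one, Module.End.one_apply] at h3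
    exact hxv.2 (Subtype.ext h3)
  have hfree : Module.Free (𝓞 F) A.lattice := inferInstance
  have hrank : Module.finrank (𝓞 F) A.lattice = 1 := by
    have h := Module.finrank_mul_finrank ℤ (𝓞 F) A.lattice
    have h2 : Module.finrank ℤ A.lattice = Module.finrank ℤ (𝓞 F) := by
      rw [A.finrank_lattice, RingOfIntegers.rank, CMType.finrank_eq_two_mul, hA.dim_eq]
    rw [h2] at h
    exact (Nat.mul_eq_left Module.finrank_pos.ne').1 h
  obtain ⟨f⟩ := Module.nonempty_linearEquiv_of_finrank_eq_one hrank
  refine ⟨f 1, (f 1).2, fun v => ⟨fun hv => ⟨f.symm ⟨v, hv⟩, ?_⟩, ?_⟩⟩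
  · rw [← hsmul, ← map_smul, smul_eq_mul, mul_one, f.apply_symm_apply]
  · rintro ⟨x, rfl⟩
    exact hmem x _ (f 1).2

/-- Dividing each coordinate by that of a generator l turns l into (1, …, 1). No coordinate of l
vanishes, since otherwise the lattice would lie in a hyperplane and could not span over ℝ. -/
theorem HasType.exists_lattice_eq [IsCMField F] (hF : classNumber F = 1) {A : ComplexTorus}
    {Φ : CMType F} (hA : A.HasType Φ) :
    ∃ e : A.Lie ≃ₗ[ℂ] (Φ.embeddings → ℂ),
      ∀ v, v ∈ A.lattice ↔ ∃ x : 𝓞 F, ∀ φ : Φ.embeddings, e v φ = (φ : F →+* ℂ) x := by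
  classical
  have := A.discrete
  have := A.isZLattice
  obtain ⟨ι, hι, e, he⟩ := id hA
  obtain ⟨l, -, hl⟩ := hA.exists_generator hF ι hι
  have hne : ∀ φ, e l φ ≠ 0 := by
    intro φ h0
    let p : A.Lie →ₗ[ℝ] ℂ := ((LinearMap.proj φ).comp e.toLinearMap).restrictScalars ℝ
    have hp : ∀ v, p v = e v φ := fun v => rfl
    have hle : Submodule.span ℝ (A.lattice : Set A.Lie) ≤ LinearMap.ker p := by
      rw [Submodule.span_le]
      intro v hv
      obtain ⟨x, rfl⟩ := (hl v).1 hv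
      simp [hp, he, h0]
    rw [IsZLattice.span_top] at hle
    have : p (e.symm (Pi.single φ 1)) = 0 := hle Submodule.mem_top
    simp [hp] at this
  let u : ∀ φ : Φ.embeddings, ℂˣ := fun φ => (Units.mk0 _ (hne φ))⁻¹
  refine ⟨e.trans (LinearEquiv.piCongrRight fun φ => LinearEquiv.smulOfUnit (u φ)), fun v => ?_⟩
  have happ : ∀ v φ, (e.trans (LinearEquiv.piCongrRight fun φ =>
      LinearEquiv.smulOfUnit (u φ))) v φ = (e l φ)⁻¹ * e v φ := fun v φ => by
    rfl
  rw [hl]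
  refine exists_congr fun x => ?_
  simp only [happ]
  constructor
  · rintro rfl φ
    rw [he]
    field_simp [hne φ]
  · intro h
    apply e.injective
    funext φ
    rw [he, ← h φ]
    field_simp [hne φ]

end ComplexTorus

/-! ### Traces, independence of embeddings, and sesquilinear forms -/

section TraceForm

open scoped ComplexConjugate

namespace CMType

variable {F : Type*} [Field F] [NumberField F] [IsCMField F]

theorem sum_embeddings (Φ : CMType F) (f : (F →+* ℂ) → ℂ) :
    ∑ χ, f χ = ∑ φ : Φ.embeddings, (f φ + f (ComplexEmbedding.conjugate φ)) := by
  classical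
  have h : Φ.embeddingsᶜ = Φ.embeddings.image ComplexEmbedding.conjugate := by
    ext φ
    rw [Finset.mem_compl, ← conjugate_mem_iff, Finset.mem_image]
    constructor
    · intro hφ
      exact ⟨_, hφ, star_star φ⟩
    · rintro ⟨ψ, hψ, rfl⟩
      simpa using hψ
  rw [Finset.sum_add_distrib, ← Finset.sum_add_sum_compl Φ.embeddings, h,
    Finset.sum_image fun φ _ ψ _ h => star_injective h,
    Finset.sum_coe_sort Φ.embeddings f,
    Finset.sum_coe_sort Φ.embeddings fun φ => f (ComplexEmbedding.conjugate φ)]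

omit [NumberField F] [IsCMField F] in
theorem linearIndependent_embeddings :
    LinearIndependent ℂ fun φ : F →+* ℂ => (φ : F → ℂ) :=
  (linearIndependent_monoidHom F ℂ).comp (fun φ : F →+* ℂ => (φ : F →* ℂ)) fun φ ψ h => by
    ext x
    exact DFunLike.congr_fun h x

/-- Twice the real part adds the conjugate term, so the hypothesis is a ℂ-linear relation among all
embeddings of F; these are linearly independent. -/
theorem eq_zero_of_sum_re_eq_zero (Φ : CMType F) (d : Φ.embeddings → ℂ)
    (h : ∀ x : F, ∑ φ : Φ.embeddings, (d φ * (φ : F →+* ℂ) x).re = 0) : d = 0 := by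
  classical
  let D : (F →+* ℂ) → ℂ := fun χ => if h : χ ∈ Φ.embeddings then d ⟨χ, h⟩ else
    conj (d ⟨ComplexEmbedding.conjugate χ, (Φ.conjugate_mem_iff χ).2 h⟩)
  have hD : ∀ φ : Φ.embeddings, D φ = d φ := fun φ => dif_pos φ.2
  have hD' : ∀ φ : Φ.embeddings, D (ComplexEmbedding.conjugate φ) = conj (d φ) := fun φ => by
    have h1 := Φ.conjugate_notMem φ φ.2
    simp only [D, dif_neg h1]
    congr 2
    exact Subtype.ext (star_star _)
  have h0 := Fintype.linearIndependent_iff.1 (linearIndependent_embeddings (F := F)) D (by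
    funext x
    rw [Finset.sum_apply, Pi.zero_apply, Φ.sum_embeddings]
    have : ∀ φ : Φ.embeddings, (D φ • (φ : F → ℂ)) x +
        (D (ComplexEmbedding.conjugate φ) • (ComplexEmbedding.conjugate (φ : F →+* ℂ) : F → ℂ)) x =
        ((2 * (d φ * (φ : F →+* ℂ) x).re : ℝ) : ℂ) := fun φ => by
      rw [hD, hD']
      simp only [Pi.smul_apply, smul_eq_mul, ComplexEmbedding.conjugate_coe_eq]
      rw [← map_mul, Complex.add_conj]
    rw [Finset.sum_congr rfl fun φ _ => this φ, ← Complex.ofReal_sum, ← Finset.mul_sum, h x,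
      mul_zero, Complex.ofReal_zero])
  funext φ
  rw [← hD, h0]
  rfl

theorem trace_eq_sum (Φ : CMType F) (x : F) :
    (Algebra.trace ℚ F x : ℝ) = ∑ φ : Φ.embeddings, 2 * ((φ : F →+* ℂ) x).re := by
  have h := trace_eq_sum_embeddings ℂ (K := ℚ) (x := x)
  rw [← (RingHom.equivRatAlgHom F ℂ).sum_comp] at h
  simp only [RingHom.equivRatAlgHom_apply, RingHom.toRatAlgHom_apply] at h
  rw [Φ.sum_embeddings fun χ => χ x] at h
  apply Complex.ofReal_injective
  push_cast
  rw [← eq_ratCast (algebraMap ℚ ℂ), h]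
  refine Finset.sum_congr rfl fun φ _ => ?_
  rw [ComplexEmbedding.conjugate_coe_eq, Complex.add_conj]
  simp

end CMType

/-- Every `K`-linear endomorphism of a finite Galois extension `L / K` is an `L`-linear combination
of the elements of the Galois group. -/
theorem exists_eq_sum_algEquiv {K L : Type*} [Field K] [Field L] [Algebra K L]
    [FiniteDimensional K L] [IsGalois K L] (T : L →ₗ[K] L) :
    ∃ c : Gal(L/K) → L, ∀ y, T y = ∑ σ, c σ * σ y := by
  classical
  have hli : LinearIndependent L fun σ : Gal(L/K) => (σ : L →ₐ[K] L).toLinearMap :=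
    (linearIndependent_toLinearMap K L L).comp (fun σ : Gal(L/K) => (σ : L →ₐ[K] L))
      fun σ τ h => AlgEquiv.coe_toAlgHom_injective h
  have hcard : Fintype.card Gal(L/K) = Module.finrank L (L →ₗ[K] L) := by
    rw [Module.finrank_linearMap_self, ← Nat.card_eq_fintype_card, IsGalois.card_aut_eq_finrank]
  let b := basisOfLinearIndependentOfCardEqFinrank hli hcard
  refine ⟨b.repr T, fun y => ?_⟩
  conv_lhs => rw [← b.sum_repr T]
  simp [b, LinearMap.sum_apply]

theorem exists_trace_eq {K L : Type*} [Field K] [Field L] [Algebra K L]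
    [FiniteDimensional K L] [Algebra.IsSeparable K L] (B : L →ₗ[K] L →ₗ[K] K) :
    ∃ T : L →ₗ[K] L, ∀ x y, B x y = Algebra.trace K L (x * T y) := by
  let e := (Algebra.traceForm K L).toDual (traceForm_nondegenerate K L)
  refine ⟨e.symm.toLinearMap.comp B.flip, fun x y => ?_⟩
  have h : e (e.symm (B.flip y)) x = B.flip y x := by rw [e.apply_symm_apply]
  rw [LinearMap.flip_apply] at h
  rw [← h, mul_comm]
  rfl

/-- A real bilinear form on `ℂ^ι` that is invariant under multiplication by `i` is the real part of
a sesquilinear form. -/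
theorem exists_eq_sum_re {ι : Type*} [Fintype ι] (E : (ι → ℂ) →ₗ[ℝ] (ι → ℂ) →ₗ[ℝ] ℝ)
    (hE : ∀ v w, E (Complex.I • v) (Complex.I • w) = E v w) :
    ∃ a : ι → ι → ℂ, ∀ v w, E v w = ∑ i, ∑ j, 2 * (a i j * conj (w j) * v i).re := by
  classical
  -- Forced by the formula: (e_i, e_j) must give 2 Re a, and (i·e_i, e_j) must give 2 Re(i a) = -2
  -- Im a.
  let s : ι → ι → ℂ := fun i j => ⟨E (Pi.single i 1) (Pi.single j 1) / 2,
    - E (Pi.single i Complex.I) (Pi.single j 1) / 2⟩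
  refine ⟨s, fun v w => ?_⟩
  have hsingle : ∀ (i : ι) (z : ℂ), (Pi.single i z : ι → ℂ) =
      z.re • (Pi.single i 1 : ι → ℂ) + z.im • (Pi.single i Complex.I : ι → ℂ) := fun i z => by
    rw [← Pi.single_smul', ← Pi.single_smul', ← Pi.single_add]
    congr 1
    apply Complex.ext <;> simp
  have hI : ∀ i : ι, Complex.I • (Pi.single i 1 : ι → ℂ) = Pi.single i Complex.I := fun i => by
    rw [← Pi.single_smul']; simp
  have hI' : ∀ i : ι, Complex.I • (Pi.single i Complex.I : ι → ℂ) = - Pi.single i 1 := fun i => by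
    rw [← Pi.single_smul', ← Pi.single_neg]; simp
  have h1 : ∀ i j, E (Pi.single i Complex.I) (Pi.single j Complex.I) =
      E (Pi.single i 1) (Pi.single j 1) := fun i j => by rw [← hI, ← hI, hE]
  have h2 : ∀ i j, E (Pi.single i 1) (Pi.single j Complex.I) =
      - E (Pi.single i Complex.I) (Pi.single j 1) := fun i j => by
    rw [← hE, hI, hI', map_neg]
  conv_lhs => rw [← Finset.univ_sum_single v, ← Finset.univ_sum_single w]
  simp only [map_sum, LinearMap.sum_apply]
  rw [Finset.sum_comm]
  refine Finset.sum_congr rfl fun i _ => Finset.sum_congr rfl fun j _ => ?_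
  rw [hsingle i (v i), hsingle j (w j)]
  simp only [map_add, map_smul, LinearMap.add_apply, LinearMap.smul_apply, smul_eq_mul, h1, h2, s,
    Complex.mul_re, Complex.mul_im, Complex.conj_re, Complex.conj_im]
  ring

end TraceForm

/-! ### Riemann forms for a simple CM-type -/

section RiemannForm

open scoped ComplexConjugate

variable {F : Type*} [Field F] [NumberField F]

/-- A bilinear form on `F` that takes integral values on `𝓞 F`. -/
theorem exists_rat_bilinForm {V : Type*} [AddCommGroup V] [Module ℚ V] [Module ℝ V]
    (E : V →ₗ[ℝ] V →ₗ[ℝ] ℝ) (j : F →+ V)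
    (hE : ∀ x y : 𝓞 F, ∃ k : ℤ, E (j x) (j y) = k) :
    ∃ B : F →ₗ[ℚ] F →ₗ[ℚ] ℚ, ∀ x y, (B x y : ℝ) = E (j x) (j y) := by
  classical
  choose k hk using hE
  let b := integralBasis F
  let B : F →ₗ[ℚ] F →ₗ[ℚ] ℚ := b.constr ℚ fun i =>
    b.constr ℚ fun i' => (k (RingOfIntegers.basis F i) (RingOfIntegers.basis F i') : ℚ)
  have hB : ∀ i i', (B (b i) (b i') : ℝ) = E (j (b i)) (j (b i')) := fun i i' => by
    have : B (b i) (b i') = (k (RingOfIntegers.basis F i) (RingOfIntegers.basis F i') : ℚ) := by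
      simp [B]
    rw [this, integralBasis_apply, integralBasis_apply, hk]
    simp
  refine ⟨B, ?_⟩
  have hq : ∀ (c : ℚ) (x : F), j (c • x) = (c : ℝ) • j x := fun c x => by
    rw [map_rat_smul, Rat.cast_smul_eq_qsmul ℝ c]
  have h1 : ∀ i y, (B (b i) y : ℝ) = E (j (b i)) (j y) := by
    intro i y
    induction b.mem_span y using Submodule.span_induction with
    | zero => simp
    | mem x hx =>
      obtain ⟨i', rfl⟩ := hx
      exact hB i i'
    | add x y _ _ hx hy => simp only [map_add, Rat.cast_add, hx, hy]
    | smul c x _ hx => simp only [map_smul, hq, smul_eq_mul, Rat.cast_mul, hx]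
  intro x y
  induction b.mem_span x using Submodule.span_induction with
  | zero => simp
  | mem x hx =>
    obtain ⟨i, rfl⟩ := hx
    exact h1 i y
  | add x y _ _ hx hy => simp only [map_add, LinearMap.add_apply, Rat.cast_add, hx, hy]
  | smul c x _ hx =>
    simp only [map_smul, hq, LinearMap.smul_apply, smul_eq_mul, Rat.cast_mul, hx]

namespace CMType

/-- The embedding of `F` into `ℂ^Φ`. -/
noncomputable def embed (Φ : CMType F) : F →+ (Φ.embeddings → ℂ) where
  toFun x := fun φ => (φ : F →+* ℂ) x
  map_zero' := by ext; simp
  map_add' x y := by ext; simp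

@[simp]
theorem embed_apply (Φ : CMType F) (x : F) (φ : Φ.embeddings) :
    Φ.embed x φ = (φ : F →+* ℂ) x := rfl

/-- For a simple CM-type, every Riemann form that is integral on `𝓞 F` comes from an element of
`F`. -/
theorem IsSimple.exists_form_eq [IsCMField F] [IsAbelianGalois ℚ F] {Φ : CMType F}
    (hΦ : Φ.IsSimple) (E : (Φ.embeddings → ℂ) →ₗ[ℝ] (Φ.embeddings → ℂ) →ₗ[ℝ] ℝ)
    (hI : ∀ v w, E (Complex.I • v) (Complex.I • w) = E v w)
    (hZ : ∀ x y : 𝓞 F, ∃ k : ℤ, E (Φ.embed x) (Φ.embed y) = k) :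
    ∃ ξ : F, ∀ v w, E v w =
      ∑ φ : Φ.embeddings, 2 * ((φ : F →+* ℂ) ξ * conj (w φ) * v φ).re := by
  classical
  obtain ⟨a, ha⟩ := exists_eq_sum_re E hI
  obtain ⟨B, hB⟩ := exists_rat_bilinForm E Φ.embed hZ
  obtain ⟨T, hT⟩ := exists_trace_eq B
  obtain ⟨c, hc⟩ := exists_eq_sum_algEquiv T
  -- For fixed y, both expressions for E(x, y), the trace and the sesquilinear sum, are real parts
  -- of combinations of the φ(x) with φ in Φ, so their coefficients agree.
  have h1 : ∀ y (φ : Φ.embeddings), (φ : F →+* ℂ) (T y) =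
      ∑ ψ : Φ.embeddings, a φ ψ * conj ((ψ : F →+* ℂ) y) := by
    intro y φ
    have := Φ.eq_zero_of_sum_re_eq_zero (fun φ => (φ : F →+* ℂ) (T y) -
      ∑ ψ : Φ.embeddings, a φ ψ * conj ((ψ : F →+* ℂ) y)) fun x => by
        have h2 := hB x y
        rw [hT, Φ.trace_eq_sum, ha, ← sub_eq_zero, ← Finset.sum_sub_distrib] at h2
        rw [← mul_eq_zero_iff_left (two_ne_zero' ℝ), Finset.mul_sum, ← h2]
        refine Finset.sum_congr rfl fun φ _ => ?_
        simp only [embed_apply, sub_mul, Complex.sub_re, Finset.sum_mul, Complex.re_sum, map_mul,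
          ← Finset.mul_sum]
        rw [mul_comm ((φ : F →+* ℂ) x)]
        ring
    exact sub_eq_zero.1 (congrFun this φ)
  -- The matrix a, re-indexed by χ = conjugate of ψ and extended by zero, so that it can be compared
  -- with Σ φ(c_σ) φσ over all embeddings.
  let d : (F →+* ℂ) → (F →+* ℂ) → ℂ := fun φ χ =>
    if h : φ ∈ Φ.embeddings ∧ ComplexEmbedding.conjugate χ ∈ Φ.embeddings then
      a ⟨φ, h.1⟩ ⟨_, h.2⟩ else 0
  have hd : ∀ φ ψ : Φ.embeddings, d φ (ComplexEmbedding.conjugate ψ) = a φ ψ := by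
    intro φ ψ
    have h2 : ComplexEmbedding.conjugate (ComplexEmbedding.conjugate (ψ : F →+* ℂ)) = ψ :=
      star_star _
    have h3 : (φ : F →+* ℂ) ∈ Φ.embeddings ∧ ComplexEmbedding.conjugate
        (ComplexEmbedding.conjugate (ψ : F →+* ℂ)) ∈ Φ.embeddings := ⟨φ.2, by rw [h2]; exact ψ.2⟩
    simp only [d, dif_pos h3]
    congr
  have hd' : ∀ φ χ, ComplexEmbedding.conjugate χ ∉ Φ.embeddings → d φ χ = 0 := fun φ χ h =>
    dif_neg fun h' => h h'.2
  let g : (F →+* ℂ) → Gal(F/ℚ) → (F →+* ℂ) := fun φ σ => φ.comp (σ : F →+* F)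
  have hginj : ∀ φ, Function.Injective (g φ) := fun φ σ τ h => by
    ext x
    exact φ.injective (RingHom.congr_fun h x)
  have hgbij : ∀ φ, Function.Bijective (g φ) := fun φ => by
    rw [Fintype.bijective_iff_injective_and_card]
    exact ⟨hginj φ, by rw [Embeddings.card, ← Nat.card_eq_fintype_card,
      IsGalois.card_aut_eq_finrank]⟩
  have h2 : ∀ (φ : Φ.embeddings) (σ : Gal(F/ℚ)), (φ : F →+* ℂ) (c σ) = d φ (g φ σ) := by
    intro φ
    have hli := (linearIndependent_embeddings (F := F)).comp (g φ) (hginj φ)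
    have := Fintype.linearIndependent_iff.1 hli
      (fun σ => (φ : F →+* ℂ) (c σ) - d φ (g φ σ)) (by
        funext y
        have h3 := h1 y φ
        have h4 : ∑ χ : F →+* ℂ, d φ χ * χ y =
            ∑ ψ : Φ.embeddings, a φ ψ * conj ((ψ : F →+* ℂ) y) := by
          rw [Φ.sum_embeddings]
          refine Finset.sum_congr rfl fun ψ _ => ?_
          rw [hd, hd' _ _ (Φ.conjugate_notMem ψ ψ.2), zero_mul, zero_add]
          rfl
        rw [← h4, ← (hgbij φ).sum_comp, hc, map_sum, ← sub_eq_zero, ← Finset.sum_sub_distrib] at h3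
        rw [Finset.sum_apply, Pi.zero_apply, ← h3]
        refine Finset.sum_congr rfl fun σ _ => ?_
        simp only [Pi.smul_apply, smul_eq_mul, Function.comp_apply, sub_mul, map_mul]
        rfl)
    exact fun σ => sub_eq_zero.1 (this σ)
  let ρ : Gal(F/ℚ) := (IsCMField.complexConj F).restrictScalars ℚ
  have hρ : ∀ φ : F →+* ℂ, ∀ x, φ (ρ x) = conj (φ x) := fun φ x =>
    IsCMField.complexEmbedding_complexConj F φ x
  have hρ1 : ρ * ρ = 1 := by
    ext x
    exact IsCMField.complexConj_apply_apply F x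
  have hgρ : ∀ φ : F →+* ℂ, ∀ σ, ComplexEmbedding.conjugate (g φ σ) = g φ (σ * ρ) := by
    intro φ σ
    ext x
    exact (hρ (φ.comp (σ : F →+* F)) x).symm
  -- If c_σ ≠ 0, then φ(c_σ) ≠ 0 for every φ in Φ, so every φσρ is in Φ; simplicity gives σρ = 1.
  have h3 : ∀ σ, c σ ≠ 0 → σ = ρ := by
    intro σ hσ
    have h4 : σ * ρ = 1 := by
      refine eq_one_of_forall_comp_mem hΦ _ fun φ hφ => ?_
      by_contra hn
      have h5 := h2 ⟨φ, hφ⟩ σ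
      rw [hd' _ _ (by rw [hgρ]; exact hn), map_eq_zero] at h5
      exact hσ h5
    rw [← mul_one σ, ← hρ1, ← mul_assoc, h4, one_mul]
  have h4 : ∀ φ ψ : Φ.embeddings, a φ ψ = if φ = ψ then (φ : F →+* ℂ) (c ρ) else 0 := by
    intro φ ψ
    obtain ⟨σ, hσ⟩ := (hgbij φ).2 (ComplexEmbedding.conjugate ψ)
    rw [← hd, ← hσ, ← h2]
    have h5 : g φ (σ * ρ) = ψ := by
      rw [← hgρ, hσ]
      exact star_star _
    split_ifs with h
    · congr 2
      have : σ * ρ = 1 := by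
        apply hginj φ
        rw [h5, ← h]
        rfl
      rw [← mul_one σ, ← hρ1, ← mul_assoc, this, one_mul]
    · rw [map_eq_zero]
      by_contra hne
      rw [h3 σ hne, hρ1] at h5
      exact h (Subtype.ext h5)
  refine ⟨c ρ, fun v w => ?_⟩
  rw [ha]
  refine Finset.sum_congr rfl fun φ _ => ?_
  rw [Finset.sum_eq_single φ]
  · rw [h4, if_pos rfl]
  · intro ψ _ hψ
    rw [h4, if_neg hψ.symm]
    simp
  · simp

end CMType

end RiemannForm

/-! ### Normal forms of principally polarized varieties -/

section NormalForm

open scoped ComplexConjugate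

variable {F : Type*} [Field F] [NumberField F]

namespace CMType

/-- The Riemann form on `ℂ^Φ` attached to an element `ξ` of `F`. -/
noncomputable def riemannForm (Φ : CMType F) (ξ : F) (v w : Φ.embeddings → ℂ) : ℝ :=
  ∑ φ : Φ.embeddings, 2 * ((φ : F →+* ℂ) ξ * conj (w φ) * v φ).re

/-- The elements of `F` whose Riemann form is a principal polarization of `ℂ^Φ / Φ(𝓞 F)`. -/
structure IsPrincipal (Φ : CMType F) (ξ : F) : Prop where
  re_eq_zero : ∀ φ ∈ Φ.embeddings, (φ ξ).re = 0
  im_neg : ∀ φ ∈ Φ.embeddings, (φ ξ).im < 0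
  isIntegral_iff : ∀ x : F, IsIntegral ℤ x ↔
    ∀ y : 𝓞 F, ∃ k : ℤ, Algebra.trace ℚ F (ξ * x * y) = k

/-- A principally polarized abelian variety isomorphic to `ℂ^Φ / Φ(𝓞 F)`, with the Riemann form
attached to `ξ`. -/
def IsNormalForm (Φ : CMType F) (ξ : F) (A : PPAV) : Prop :=
  ∃ e : A.Lie ≃ₗ[ℂ] (Φ.embeddings → ℂ),
    (∀ v, v ∈ A.lattice ↔ ∃ x : 𝓞 F, e v = Φ.embed x) ∧
    ∀ v w, A.form v w = Φ.riemannForm ξ (e v) (e w)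

variable {Φ : CMType F}

theorem nonempty (Φ : CMType F) : Φ.embeddings.Nonempty := by
  rw [← Finset.card_pos, Φ.card_eq]
  exact Module.finrank_pos

theorem embed_injective (Φ : CMType F) : Function.Injective Φ.embed := fun x y h => by
  obtain ⟨φ, hφ⟩ := Φ.nonempty
  exact φ.injective (congrFun h ⟨φ, hφ⟩)

theorem IsPrincipal.ne_zero {ξ : F} (h : Φ.IsPrincipal ξ) : ξ ≠ 0 := by
  rintro rfl
  obtain ⟨φ, hφ⟩ := Φ.nonempty
  simpa using h.im_neg φ hφ

theorem embed_complexConj [IsCMField F] (Φ : CMType F) (x : F) (φ : Φ.embeddings) :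
    Φ.embed (IsCMField.complexConj F x) φ = conj (Φ.embed x φ) :=
  IsCMField.complexEmbedding_complexConj F φ x

theorem riemannForm_embed [IsCMField F] (Φ : CMType F) (ξ x y : F) :
    Φ.riemannForm ξ (Φ.embed x) (Φ.embed y) =
      Algebra.trace ℚ F (ξ * IsCMField.complexConj F y * x) := by
  rw [Φ.trace_eq_sum, riemannForm]
  refine Finset.sum_congr rfl fun φ _ => ?_
  rw [map_mul, map_mul, ← embed_complexConj]
  rfl

theorem riemannForm_single [DecidableEq Φ.embeddings] (ξ : F) (φ : Φ.embeddings) (z w : ℂ) :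
    Φ.riemannForm ξ (Pi.single φ z) (Pi.single φ w) =
      2 * ((φ : F →+* ℂ) ξ * conj w * z).re := by
  rw [riemannForm, Finset.sum_eq_single φ]
  · simp
  · intro ψ _ h
    simp [h]
  · simp

theorem IsNormalForm.isPrincipal [IsCMField F] {ξ : F} {A : PPAV} (h : Φ.IsNormalForm ξ A) :
    Φ.IsPrincipal ξ := by
  classical
  have := A.discrete
  have := A.isZLattice
  obtain ⟨e, he, hE⟩ := h
  have hA := A.isPrincipalPolarization
  have hmem : ∀ x : 𝓞 F, e.symm (Φ.embed x) ∈ A.lattice := fun x =>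
    (he _).2 ⟨x, e.apply_symm_apply _⟩
  refine ⟨fun φ hφ => ?_, fun φ hφ => ?_, fun x => ⟨fun hx y => ?_, fun hx => ?_⟩⟩
  · have h1 := hA.alternating (e.symm (Pi.single ⟨φ, hφ⟩ 1))
    rw [hE, e.apply_symm_apply, riemannForm_single] at h1
    simpa using h1
  -- On the φ-axis E(iv, v) = -2 Im φ(ξ) |v|², which is where the negative sign comes from.
  · have h1 := hA.pos (e.symm (Pi.single ⟨φ, hφ⟩ 1)) (by simp)
    rw [hE, map_smul, e.apply_symm_apply, ← Pi.single_smul', riemannForm_single] at h1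
    simp at h1
    linarith
  · obtain ⟨x, rfl⟩ : ∃ z : 𝓞 F, (z : F) = x := ⟨⟨x, hx⟩, rfl⟩
    obtain ⟨k, hk⟩ := hA.integral _ (hmem y) _
      (hmem (IsCMField.ringOfIntegersComplexConj F x))
    rw [hE, e.apply_symm_apply, e.apply_symm_apply, riemannForm_embed] at hk
    refine ⟨k, ?_⟩
    rw [IsCMField.coe_ringOfIntegersComplexConj, IsCMField.complexConj_apply_apply] at hk
    exact_mod_cast hk
  · let w := e.symm (Φ.embed (IsCMField.complexConj F x))
    have hw : ∀ v : A.lattice, ∃ k : ℤ, A.form v w = k := by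
      intro v
      obtain ⟨y, hy⟩ := (he _).1 v.2
      obtain ⟨k, hk⟩ := hx y
      refine ⟨k, ?_⟩
      rw [hE, e.apply_symm_apply, hy, riemannForm_embed, IsCMField.complexConj_apply_apply, hk]
      simp
    choose k hk using hw
    obtain ⟨w', hw', hw''⟩ := hA.selfDual (AddMonoidHom.mk' k fun v v' => by
      have : ((k (v + v') : ℤ) : ℝ) = ((k v + k v' : ℤ) : ℝ) := by
        rw [Int.cast_add, ← hk, ← hk, ← hk]
        simp
      exact_mod_cast this)
    -- The two functionals agree on the lattice, hence on its real span; positivity then gives w' =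
    -- w.
    have h0 : ∀ v, A.form v (w' - w) = 0 := by
      have hle : Submodule.span ℝ (A.lattice : Set A.Lie) ≤
          LinearMap.ker (A.form.flip (w' - w)) := by
        rw [Submodule.span_le]
        intro v hv
        have := hw'' ⟨v, hv⟩
        rw [AddMonoidHom.mk'_apply, ← hk] at this
        simp [this]
      rw [IsZLattice.span_top] at hle
      exact fun v => hle (Submodule.mem_top (x := v))
    have h1 : w' = w := by
      by_contra hne
      exact (hA.pos _ (sub_ne_zero.2 hne)).ne' (h0 _)
    obtain ⟨z, hz⟩ := (he _).1 hw'
    rw [h1, e.apply_symm_apply] at hz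
    have h2 := Φ.embed_injective hz
    have h3 : x = IsCMField.ringOfIntegersComplexConj F z := by
      rw [IsCMField.coe_ringOfIntegersComplexConj, ← h2, IsCMField.complexConj_apply_apply]
    rw [h3]
    exact RingOfIntegers.isIntegral_coe _

/-- For a simple CM-type, every principally polarized abelian variety of type `(𝓞 F, Φ)` has a
normal form. -/
theorem IsSimple.exists_isNormalForm [IsCMField F] [IsAbelianGalois ℚ F] (hΦ : Φ.IsSimple)
    (hF : classNumber F = 1) {A : PPAV} (hA : A.HasType Φ) : ∃ ξ, Φ.IsNormalForm ξ A := by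
  obtain ⟨e, he⟩ := hA.exists_lattice_eq hF
  have he' : ∀ v, v ∈ A.lattice ↔ ∃ x : 𝓞 F, e v = Φ.embed x := fun v =>
    (he v).trans (exists_congr fun x => funext_iff.symm)
  let f := (e.restrictScalars ℝ).symm.toLinearMap
  have hf : ∀ v, f v = e.symm v := fun _ => rfl
  obtain ⟨ξ, hξ⟩ := hΦ.exists_form_eq (A.form.compl₁₂ f f)
    (fun v w => by
      simp only [LinearMap.compl₁₂_apply, hf, map_smul]
      exact A.isPrincipalPolarization.map_I_smul _ _)
    (fun x y => by
      simp only [LinearMap.compl₁₂_apply, hf]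
      exact A.isPrincipalPolarization.integral _ ((he' _).2 ⟨x, e.apply_symm_apply _⟩)
        _ ((he' _).2 ⟨y, e.apply_symm_apply _⟩))
  refine ⟨ξ, e, he', fun v w => ?_⟩
  rw [riemannForm, ← hξ]
  simp [hf]

/-- The isomorphism is multiplication by u: it is diagonal on ℂ^Φ, preserves Φ(𝓞 F), and pulls the
form of ξ' back to that of ξ'uū. -/
theorem IsNormalForm.isIsomorphic [IsCMField F] {ξ ξ' : F} {A B : PPAV}
    (hA : Φ.IsNormalForm ξ A) (hB : Φ.IsNormalForm ξ' B) (u : (𝓞 F)ˣ)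
    (hu : ξ = ξ' * (u * IsCMField.complexConj F u)) : A.IsIsomorphic B := by
  obtain ⟨e, he, hE⟩ := hA
  obtain ⟨e', he', hE'⟩ := hB
  let c : ∀ φ : Φ.embeddings, ℂˣ := fun φ =>
    Units.map ((φ : F →+* ℂ).comp (algebraMap (𝓞 F) F) : 𝓞 F →* ℂ) u
  let M : (Φ.embeddings → ℂ) ≃ₗ[ℂ] (Φ.embeddings → ℂ) :=
    LinearEquiv.piCongrRight fun φ => LinearEquiv.smulOfUnit (c φ)
  have hM : ∀ v φ, M v φ = (φ : F →+* ℂ) u * v φ := fun _ _ => rfl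
  have hM' : ∀ x : F, M (Φ.embed x) = Φ.embed (u * x) := fun x => by
    funext φ
    rw [hM, embed_apply, embed_apply, map_mul]
  have hf : ∀ v, e' ((e.trans M).trans e'.symm v) = M (e v) := fun v => by simp
  refine ⟨(e.trans M).trans e'.symm, fun v => ?_, fun v w => ?_⟩
  · rw [he', he, hf]
    constructor
    · rintro ⟨x, hx⟩
      refine ⟨(u⁻¹ : (𝓞 F)ˣ) * x, M.injective ?_⟩
      rw [hx, hM']
      congr 1
      exact_mod_cast (u.mul_inv_cancel_left x).symm
    · rintro ⟨x, hx⟩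
      refine ⟨u * x, ?_⟩
      rw [hx, hM']
      rfl
  · rw [hE', hE, hf, hf, riemannForm, riemannForm]
    refine Finset.sum_congr rfl fun φ _ => ?_
    rw [hM, hM, hu, map_mul, map_mul _ ξ', map_mul _ (algebraMap (𝓞 F) F u),
      IsCMField.complexEmbedding_complexConj]
    congr 2
    ring

end CMType

end NormalForm

/-! ### The polarized torus ℂ^Φ/Φ(𝓞 F) -/

section Torus

open scoped ComplexConjugate

variable {F : Type*} [Field F] [NumberField F] [IsCMField F]

namespace CMType

/-- A real relation between the Φ-coordinates holds for the conjugate coordinates too, so it is a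
relation in the lattice basis of the full canonical embedding. -/
theorem linearIndependent_embed (Φ : CMType F) :
    LinearIndependent ℝ fun i => Φ.embed (integralBasis F i) := by
  classical
  rw [Fintype.linearIndependent_iff]
  intro g hg
  have h := Fintype.linearIndependent_iff.1 (canonicalEmbedding.latticeBasis F).linearIndependent
    (fun i => (g i : ℂ)) (by
      have h1 : ∀ φ ∈ Φ.embeddings, ∑ i, (g i : ℂ) * φ (integralBasis F i) = 0 := fun φ hφ => by
        have := congrFun hg ⟨φ, hφ⟩
        simpa [Finset.sum_apply] using this
      funext χ
      rw [Finset.sum_apply, Pi.zero_apply]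
      simp only [canonicalEmbedding.latticeBasis_apply, Pi.smul_apply, smul_eq_mul,
        canonicalEmbedding.apply_at]
      rcases Φ.mem_or_conjugate_mem χ with hχ | hχ
      · exact h1 χ hχ
      · have := congrArg conj (h1 _ hχ)
        simpa [map_sum] using this)
  intro i
  exact_mod_cast h i

/-- The images of an integral basis of `F` form a real basis of `ℂ^Φ`. -/
noncomputable def embedBasis (Φ : CMType F) :
    Module.Basis (Module.Free.ChooseBasisIndex ℤ (𝓞 F)) ℝ (Φ.embeddings → ℂ) :=
  basisOfLinearIndependentOfCardEqFinrank Φ.linearIndependent_embed (by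
    rw [← Module.finrank_mul_finrank ℝ ℂ, Complex.finrank_real_complex,
      Module.finrank_fintype_fun_eq_card, Fintype.card_coe, Φ.card_eq, ← finrank_eq_two_mul,
      Module.finrank_eq_card_basis (integralBasis F)])

theorem embedBasis_apply (Φ : CMType F) (i) : Φ.embedBasis i = Φ.embed (integralBasis F i) := by
  simp [embedBasis]

theorem mem_span_embedBasis (Φ : CMType F) (v : Φ.embeddings → ℂ) :
    v ∈ Submodule.span ℤ (Set.range Φ.embedBasis) ↔ ∃ x : 𝓞 F, v = Φ.embed x := by
  have h1 : Set.range Φ.embedBasis = Φ.embed.toIntLinearMap '' Set.range (integralBasis F) := by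
    rw [← Set.range_comp]
    exact congrArg Set.range (funext Φ.embedBasis_apply)
  rw [h1, ← Submodule.map_span]
  simp only [Submodule.mem_map, mem_span_integralBasis]
  constructor
  · rintro ⟨_, ⟨x, rfl⟩, rfl⟩
    exact ⟨x, rfl⟩
  · rintro ⟨x, rfl⟩
    exact ⟨x, ⟨x, rfl⟩, rfl⟩

/-- An indexing of the coordinates of `ℂ^Φ`. -/
noncomputable def coord (Φ : CMType F) :
    (Fin Φ.embeddings.card → ℂ) ≃ₗ[ℂ] (Φ.embeddings → ℂ) :=
  LinearEquiv.funCongrLeft ℂ ℂ Φ.embeddings.equivFin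

/-- The complex torus `ℂ^Φ / Φ(𝓞 F)`. -/
noncomputable def torus (Φ : CMType F) : ComplexTorus where
  dim := Φ.embeddings.card
  lattice := Submodule.span ℤ
    (Set.range (Φ.embedBasis.map (Φ.coord.restrictScalars ℝ).symm))
  discrete := inferInstance
  isZLattice := inferInstance

theorem mem_span_embedBasis_map (Φ : CMType F) (v : Fin Φ.embeddings.card → ℂ) :
    v ∈ Submodule.span ℤ (Set.range (Φ.embedBasis.map (Φ.coord.restrictScalars ℝ).symm)) ↔
      ∃ x : 𝓞 F, Φ.coord v = Φ.embed x := by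
  rw [← mem_span_embedBasis]
  have h : Set.range (Φ.embedBasis.map (Φ.coord.restrictScalars ℝ).symm) =
      (Φ.coord.restrictScalars ℤ).symm.toLinearMap '' Set.range Φ.embedBasis := by
    rw [← Set.range_comp]
    exact congrArg Set.range (funext fun i => by simp)
  rw [h, ← Submodule.map_span, Submodule.mem_map]
  constructor
  · rintro ⟨w, hw, rfl⟩
    simpa using hw
  · intro hv
    exact ⟨_, hv, by simp⟩

/-- The coordinates on the universal cover of `ℂ^Φ / Φ(𝓞 F)`. -/
noncomputable def torusCoord (Φ : CMType F) : Φ.torus.Lie ≃ₗ[ℂ] (Φ.embeddings → ℂ) :=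
  Φ.coord

theorem mem_torus_lattice (Φ : CMType F) (v : Φ.torus.Lie) :
    v ∈ Φ.torus.lattice ↔ ∃ x : 𝓞 F, Φ.torusCoord v = Φ.embed x :=
  Φ.mem_span_embedBasis_map v

theorem torus_hasType (Φ : CMType F) : Φ.torus.HasType Φ := by
  let ι : F →+* Module.End ℂ Φ.torus.Lie :=
    (Φ.torusCoord.symm.conjRingEquiv.toRingHom.comp
      (Algebra.lmul ℂ (Φ.embeddings → ℂ)).toRingHom).comp
      (RingHom.pi fun φ : Φ.embeddings => (φ : F →+* ℂ))
  have hι : ∀ (x : F) (v : Φ.torus.Lie) (φ : Φ.embeddings),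
      Φ.torusCoord (ι x v) φ = (φ : F →+* ℂ) x * Φ.torusCoord v φ := fun x v φ => by
    change Φ.torusCoord (Φ.torusCoord.symm _) φ = _
    rw [Φ.torusCoord.apply_symm_apply]
    rfl
  have hι' : ∀ (x : F) (v : Φ.torus.Lie) (y : F), Φ.torusCoord v = Φ.embed y →
      Φ.torusCoord (ι x v) = Φ.embed (x * y) := fun x v y h => by
    funext φ
    rw [hι, h, embed_apply, embed_apply, map_mul]
  refine ⟨ι, fun x => ⟨fun h => ?_, fun h => ?_⟩, Φ.torusCoord, hι⟩
  -- An x that preserves the lattice sends the lattice point 1 to x, so x is integral.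
  · have h1 : Φ.torusCoord (Φ.torusCoord.symm (Φ.embed ((1 : 𝓞 F) : F))) = Φ.embed ((1 : 𝓞 F) : F) :=
      Φ.torusCoord.apply_symm_apply _
    obtain ⟨y, hy⟩ := (Φ.mem_torus_lattice _).1 (h _ ((Φ.mem_torus_lattice _).2 ⟨1, h1⟩))
    rw [hι' x _ _ h1] at hy
    have := Φ.embed_injective hy
    rw [RingOfIntegers.coe_eq_algebraMap, map_one, mul_one] at this
    rw [this]
    exact y.isIntegral_coe
  · intro v hv
    obtain ⟨y, hy⟩ := (Φ.mem_torus_lattice _).1 hv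
    obtain ⟨x, rfl⟩ : ∃ z : 𝓞 F, (z : F) = x := ⟨⟨x, h⟩, rfl⟩
    exact (Φ.mem_torus_lattice _).2 ⟨x * y, hι' _ _ _ hy⟩

/-- The Riemann form attached to `ξ`, as a bilinear form on the universal cover of
`ℂ^Φ / Φ(𝓞 F)`. -/
noncomputable def torusForm (Φ : CMType F) (ξ : F) : Φ.torus.Lie →ₗ[ℝ] Φ.torus.Lie →ₗ[ℝ] ℝ :=
  LinearMap.mk₂ ℝ (fun v w => Φ.riemannForm ξ (Φ.torusCoord v) (Φ.torusCoord w))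
    (fun v v' w => by
      simp only [riemannForm, map_add, Pi.add_apply, mul_add, Complex.add_re,
        Finset.sum_add_distrib])
    (fun c v w => by
      have : Φ.torusCoord (c • v) = c • Φ.torusCoord v := (Φ.torusCoord.restrictScalars ℝ).map_smul c v
      simp only [riemannForm, this, Pi.smul_apply, smul_eq_mul, Finset.mul_sum, Complex.real_smul]
      refine Finset.sum_congr rfl fun φ _ => ?_
      rw [mul_left_comm _ (c : ℂ), Complex.re_ofReal_mul]
      ring)
    (fun v w w' => by
      simp only [riemannForm, map_add, Pi.add_apply, mul_add, add_mul, Complex.add_re,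
        Finset.sum_add_distrib])
    (fun c v w => by
      have : Φ.torusCoord (c • w) = c • Φ.torusCoord w := (Φ.torusCoord.restrictScalars ℝ).map_smul c w
      simp only [riemannForm, this, Pi.smul_apply, smul_eq_mul, Finset.mul_sum, Complex.real_smul,
        map_mul, Complex.conj_ofReal]
      refine Finset.sum_congr rfl fun φ _ => ?_
      rw [mul_left_comm _ (c : ℂ), mul_assoc (c : ℂ), Complex.re_ofReal_mul]
      ring)

theorem torusForm_apply (Φ : CMType F) (ξ : F) (v w : Φ.torus.Lie) :
    Φ.torusForm ξ v w = Φ.riemannForm ξ (Φ.torusCoord v) (Φ.torusCoord w) := rfl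

omit [IsCMField F] in
-- Over ℚ the functional is y ↦ Tr(ηy) by nondegeneracy of the trace. As η lies in the trace dual of
-- 𝓞 F, which is ξ𝓞 F, one takes z = η/ξ.
theorem IsPrincipal.exists_trace_eq {Φ : CMType F} {ξ : F} (hξ : Φ.IsPrincipal ξ)
    (f : 𝓞 F →+ ℤ) : ∃ z : 𝓞 F, ∀ y : 𝓞 F, Algebra.trace ℚ F (ξ * z * y) = f y := by
  let b := integralBasis F
  let g : F →ₗ[ℚ] ℚ := b.constr ℚ fun i => (f (RingOfIntegers.basis F i) : ℚ)
  have hg : ∀ y : 𝓞 F, g y = f y := by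
    intro y
    let p : 𝓞 F →ₗ[ℤ] ℚ := (g.restrictScalars ℤ).comp (Algebra.linearMap (𝓞 F) F |>.restrictScalars ℤ)
    let q : 𝓞 F →ₗ[ℤ] ℚ := ((Int.castAddHom ℚ).comp f).toIntLinearMap
    have hpq : p = q := by
      refine (RingOfIntegers.basis F).ext fun i => ?_
      change g (algebraMap (𝓞 F) F (RingOfIntegers.basis F i)) = (f (RingOfIntegers.basis F i) : ℚ)
      rw [← integralBasis_apply]
      exact b.constr_basis ℚ _ i
    exact LinearMap.congr_fun hpq y
  let e := (Algebra.traceForm ℚ F).toDual (traceForm_nondegenerate ℚ F)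
  have he : ∀ y, Algebra.trace ℚ F (e.symm g * y) = g y := fun y => by
    have : e (e.symm g) y = g y := by rw [e.apply_symm_apply]
    rw [← this]
    rfl
  have h1 : ξ * (e.symm g / ξ) = e.symm g := mul_div_cancel₀ _ hξ.ne_zero
  have hz : IsIntegral ℤ (e.symm g / ξ) := (hξ.isIntegral_iff _).2 fun y =>
    ⟨f y, by rw [h1, he, hg]⟩
  refine ⟨⟨_, hz⟩, fun y => ?_⟩
  rw [← hg, ← he]
  congr 2

theorem IsPrincipal.isPrincipalPolarization {Φ : CMType F} {ξ : F} (hξ : Φ.IsPrincipal ξ) :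
    Φ.torus.IsPrincipalPolarization (Φ.torusForm ξ) where
  alternating v := by
    rw [torusForm_apply, riemannForm]
    refine Finset.sum_eq_zero fun φ _ => ?_
    rw [mul_assoc, mul_comm (conj _), Complex.mul_conj, Complex.re_mul_ofReal,
      hξ.re_eq_zero φ φ.2]
    simp
  map_I_smul v w := by
    rw [torusForm_apply, torusForm_apply, map_smul, map_smul, riemannForm, riemannForm]
    refine Finset.sum_congr rfl fun φ _ => ?_
    congr 2
    simp only [Pi.smul_apply, smul_eq_mul, map_mul, Complex.conj_I]
    linear_combination (-(φ : F →+* ℂ) ξ * conj (Φ.torusCoord w φ) * Φ.torusCoord v φ) * Complex.I_mul_I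
  pos v hv := by
    have h0 : ∀ φ : Φ.embeddings, (2 * ((φ : F →+* ℂ) ξ * conj (Φ.torusCoord v φ) *
        (Complex.I • Φ.torusCoord v) φ).re) =
        2 * (-((φ : F →+* ℂ) ξ).im) * Complex.normSq (Φ.torusCoord v φ) := fun φ => by
      rw [Pi.smul_apply, smul_eq_mul, show (φ : F →+* ℂ) ξ * conj (Φ.torusCoord v φ) *
        (Complex.I * Φ.torusCoord v φ) = ((φ : F →+* ℂ) ξ * Complex.I) *
          (Φ.torusCoord v φ * conj (Φ.torusCoord v φ)) by ring, Complex.mul_conj, Complex.re_mul_ofReal,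
        Complex.mul_I_re]
      ring
    have hne : Φ.torusCoord v ≠ 0 := by simpa using hv
    obtain ⟨φ, hφ⟩ := Function.ne_iff.1 hne
    rw [torusForm_apply, map_smul, riemannForm, Finset.sum_congr rfl fun φ _ => h0 φ]
    refine Finset.sum_pos' (fun ψ _ => ?_) ⟨φ, Finset.mem_univ _, ?_⟩
    · have := hξ.im_neg ψ ψ.2
      have := Complex.normSq_nonneg (Φ.torusCoord v ψ)
      exact mul_nonneg (by linarith) this
    · have := hξ.im_neg φ φ.2
      exact mul_pos (by linarith) (Complex.normSq_pos.2 hφ)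
  integral v hv w hw := by
    obtain ⟨x, hx⟩ := (Φ.mem_torus_lattice _).1 hv
    obtain ⟨y, hy⟩ := (Φ.mem_torus_lattice _).1 hw
    rw [torusForm_apply, hx, hy, riemannForm_embed, ← IsCMField.coe_ringOfIntegersComplexConj]
    obtain ⟨k, hk⟩ := (hξ.isIntegral_iff _).1
      (IsCMField.ringOfIntegersComplexConj F y).isIntegral_coe x
    exact ⟨k, by rw [hk]; simp⟩
  selfDual f := by
    have hmem : ∀ x : 𝓞 F, Φ.torusCoord.symm (Φ.embed x) ∈ Φ.torus.lattice := fun x =>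
      (Φ.mem_torus_lattice _).2 ⟨x, Φ.torusCoord.apply_symm_apply _⟩
    obtain ⟨z, hz⟩ := hξ.exists_trace_eq (AddMonoidHom.mk'
      (fun x => f ⟨Φ.torusCoord.symm (Φ.embed x), hmem x⟩) fun x y => by
        rw [← map_add]
        congr 1
        ext1
        simp only [RingOfIntegers.coe_eq_algebraMap, map_add]
        rfl)
    refine ⟨_, hmem (IsCMField.ringOfIntegersComplexConj F z), fun v => ?_⟩
    obtain ⟨x, hx⟩ := (Φ.mem_torus_lattice _).1 v.2
    rw [torusForm_apply, hx, Φ.torusCoord.apply_symm_apply, riemannForm_embed,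
      IsCMField.coe_ringOfIntegersComplexConj, IsCMField.complexConj_apply_apply, hz,
      AddMonoidHom.mk'_apply]
    have : (⟨Φ.torusCoord.symm (Φ.embed x), hmem x⟩ : Φ.torus.lattice) = v :=
      Subtype.ext (by rw [Subtype.coe_mk, ← hx, LinearEquiv.symm_apply_apply])
    rw [this]
    simp

theorem IsPrincipal.exists_hasType {Φ : CMType F} {ξ : F} (hξ : Φ.IsPrincipal ξ) :
    ∃ A : PPAV, A.HasType Φ :=
  ⟨⟨Φ.torus, Φ.torusForm ξ, hξ.isPrincipalPolarization⟩, Φ.torus_hasType⟩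

end CMType

end Torus

/-! ### Signatures of units and the narrow class number -/

section SignedUnits

variable (K : Type*) [Field K] [NumberField K]

/-- The units of the ring of integers, as a subgroup of the multiplicative group of the field. -/
def integralUnits : Subgroup Kˣ :=
  (Units.map (algebraMap (𝓞 K) K : 𝓞 K →* K)).range

/-- The elements of `K` that are the product of a unit and a totally positive element. -/
def unitsMulTotallyPositive : Subgroup Kˣ := integralUnits K ⊔ totallyPositive K

variable {K}

omit [NumberField K] in
theorem mem_integralUnits {a : Kˣ} : a ∈ integralUnits K ↔ ∃ u : (𝓞 K)ˣ, (u : K) = a := by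
  simp [integralUnits, MonoidHom.mem_range, Units.ext_iff]

omit [NumberField K] in
theorem mem_totallyPositive {a : Kˣ} : a ∈ totallyPositive K ↔ ∀ τ : K →+* ℝ, 0 < τ a :=
  Iff.rfl

omit [NumberField K] in
theorem mem_unitsMulTotallyPositive {a : Kˣ} : a ∈ unitsMulTotallyPositive K ↔
    ∃ u : (𝓞 K)ˣ, ∀ τ : K →+* ℝ, 0 < τ u * τ a := by
  rw [unitsMulTotallyPositive, Subgroup.mem_sup]
  constructor
  · rintro ⟨b, hb, c, hc, rfl⟩
    obtain ⟨u, hu⟩ := mem_integralUnits.1 hb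
    refine ⟨u, fun τ => ?_⟩
    have h1 : τ b ≠ 0 := by simp
    have h2 := hc τ
    rw [hu, Units.val_mul, map_mul, ← mul_assoc]
    exact mul_pos (mul_self_pos.2 h1) h2
  · rintro ⟨u, hu⟩
    let b : Kˣ := Units.map (algebraMap (𝓞 K) K : 𝓞 K →* K) u
    refine ⟨b⁻¹, inv_mem ⟨u, rfl⟩, b * a, fun τ => ?_, by simp⟩
    rw [Units.val_mul, map_mul]
    exact hu τ

theorem ker_toPrincipalIdeal_le : (toPrincipalIdeal (𝓞 K) K).ker ≤ integralUnits K := by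
  intro a ha
  rw [MonoidHom.mem_ker, toPrincipalIdeal_eq_iff, Units.val_one,
    ← FractionalIdeal.spanSingleton_one, FractionalIdeal.ext_iff] at ha
  have h1 : (a : K) ∈ FractionalIdeal.spanSingleton (𝓞 K)⁰ (1 : K) :=
    (ha _).1 (FractionalIdeal.mem_spanSingleton_self _ _)
  have h2 : (1 : K) ∈ FractionalIdeal.spanSingleton (𝓞 K)⁰ (a : K) :=
    (ha _).2 (FractionalIdeal.mem_spanSingleton_self _ _)
  obtain ⟨x, hx⟩ := (FractionalIdeal.mem_spanSingleton _).1 h1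
  obtain ⟨y, hy⟩ := (FractionalIdeal.mem_spanSingleton _).1 h2
  rw [Algebra.smul_def, mul_one] at hx
  rw [Algebra.smul_def, ← hx, ← map_mul] at hy
  have hxy : y * x = 1 := by
    apply RingOfIntegers.coe_injective
    rw [hy, map_one]
  exact mem_integralUnits.2 ⟨⟨x, y, by rw [mul_comm, hxy], hxy⟩, hx⟩

/-- Sending a to the class of (a) maps Kˣ to the narrow class group with kernel inside UP, so the
index of UP divides the order of the image. Only this divisibility is needed, not the class number
of K. -/
theorem index_unitsMulTotallyPositive_dvd :
    (unitsMulTotallyPositive K).index ∣ narrowClassNumber K := by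
  let P := (totallyPositive K).map (toPrincipalIdeal (𝓞 K) K)
  let f : Kˣ →* NarrowClassGroup K := (QuotientGroup.mk' P).comp (toPrincipalIdeal (𝓞 K) K)
  have hf : f.ker ≤ unitsMulTotallyPositive K := by
    intro a ha
    have h1 : toPrincipalIdeal (𝓞 K) K a ∈ P := (QuotientGroup.eq_one_iff _).1 ha
    obtain ⟨b, hb, hab⟩ := Subgroup.mem_map.1 h1
    have h2 : a * b⁻¹ ∈ integralUnits K := ker_toPrincipalIdeal_le (by
      rw [MonoidHom.mem_ker, map_mul, map_inv, hab, mul_inv_cancel])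
    rw [← inv_mul_cancel_right a b]
    exact Subgroup.mul_mem_sup h2 hb
  refine (Subgroup.index_dvd_of_le hf).trans ?_
  rw [Subgroup.index_ker]
  exact Subgroup.card_subgroup_dvd_card _

section Embeddings

omit [NumberField K] in
theorem infinitePlace_mk_ofReal (τ : K →+* ℝ) (x : K) :
    InfinitePlace.mk (Complex.ofRealHom.comp τ) x = |τ x| := by
  simp [InfinitePlace.apply]

omit [NumberField K] in
theorem isReal_ofReal (τ : K →+* ℝ) : ComplexEmbedding.IsReal (Complex.ofRealHom.comp τ) := by
  rw [ComplexEmbedding.isReal_iff]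
  ext x
  simp

omit [NumberField K] in
theorem ofReal_comp_injective :
    Function.Injective fun τ : K →+* ℝ => Complex.ofRealHom.comp τ := fun τ τ' h => by
  ext x
  simpa using RingHom.congr_fun h x

noncomputable instance : Fintype (K →+* ℝ) :=
  Fintype.ofInjective _ ofReal_comp_injective

theorem card_real_embeddings [IsTotallyReal K] :
    Fintype.card (K →+* ℝ) = Module.finrank ℚ K := by
  rw [← Embeddings.card K ℂ]
  refine Fintype.card_of_bijective (f := fun τ => Complex.ofRealHom.comp τ)
    ⟨ofReal_comp_injective, fun φ => ?_⟩
  have hφ := IsTotallyReal.complexEmbedding_isReal φ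
  refine ⟨hφ.embedding, ?_⟩
  ext x
  exact hφ.coe_embedding_apply x

/-- Weak approximation gives a with |τ₀ a| > 1 and |τ a| < 1 at all other τ; then 1 - a² has the
required signs. -/
theorem exists_neg_iff_eq (τ₀ : K →+* ℝ) :
    ∃ a : Kˣ, ∀ τ : K →+* ℝ, τ a < 0 ↔ τ = τ₀ := by
  let w : (K →+* ℝ) → InfinitePlace K := fun τ => InfinitePlace.mk (Complex.ofRealHom.comp τ)
  have hw : Function.Injective w := by
    intro τ τ' h
    apply ofReal_comp_injective
    rcases InfinitePlace.mk_eq_iff.1 h with h | h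
    · exact h
    · rwa [ComplexEmbedding.isReal_iff.1 (isReal_ofReal τ)] at h
  obtain ⟨a, ha, ha'⟩ := AbsoluteValue.exists_one_lt_lt_one_pi_of_not_isEquiv
    (v := fun v : InfinitePlace K => v.1) (fun v => v.isNontrivial)
    (fun _ _ h => (InfinitePlace.eq_iff_isEquiv (K := K)).not.mp h) (w τ₀)
  have h1 : 1 < |τ₀ a| := by rw [← infinitePlace_mk_ofReal]; exact ha
  have h2 : ∀ τ, τ ≠ τ₀ → |τ a| < 1 := fun τ hτ => by
    rw [← infinitePlace_mk_ofReal]; exact ha' _ (hw.ne hτ)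
  have h3 : τ₀ (1 - a ^ 2) < 0 := by
    rw [map_sub, map_one, map_pow]
    have := (one_lt_sq_iff_one_lt_abs (τ₀ a)).2 h1
    linarith
  refine ⟨Units.mk0 (1 - a ^ 2) (by rintro h; rw [h, map_zero] at h3; exact h3.false),
    fun τ => ⟨fun h => ?_, ?_⟩⟩
  · by_contra hτ
    rw [Units.val_mk0, map_sub, map_one, map_pow] at h
    have := (sq_lt_one_iff_abs_lt_one (τ a)).2 (h2 τ hτ)
    linarith
  · rintro rfl
    exact h3

end Embeddings

/-- The signs of an element under the real embeddings. -/
noncomputable def signs : Kˣ →* ((K →+* ℝ) → SignTypeˣ) :=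
  MonoidHom.pi fun τ => Units.map ((signHom : ℝ →*₀ SignType).toMonoidHom.comp (τ : K →* ℝ))

omit [NumberField K] in
theorem signs_apply (a : Kˣ) (τ : K →+* ℝ) : (signs a τ : SignType) = SignType.sign (τ a) := rfl

omit [NumberField K] in
theorem ker_signs : (signs (K := K)).ker = totallyPositive K := by
  ext a
  rw [MonoidHom.mem_ker, mem_totallyPositive, funext_iff]
  refine forall_congr' fun τ => ?_
  rw [Units.ext_iff, signs_apply, Pi.one_apply, Units.val_one, sign_eq_one_iff]

theorem signs_surjective : Function.Surjective (signs (K := K)) := by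
  classical
  intro s
  choose a ha using exists_neg_iff_eq (K := K)
  refine ⟨∏ τ, if s τ = 1 then 1 else a τ, ?_⟩
  funext τ
  have h1 : ∀ x : SignTypeˣ, x = 1 ∨ x = -1 := by decide
  have h2 : ∀ τ', signs (a τ') τ = if τ' = τ then -1 else 1 := by
    intro τ'
    ext1
    rw [signs_apply]
    split_ifs with h
    · rw [Units.val_neg, Units.val_one, sign_eq_neg_one_iff, ha, h]
    · rw [Units.val_one, sign_eq_one_iff]
      refine lt_of_le_of_ne (not_lt.1 ?_) (Ne.symm (by simp))
      rw [ha]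
      exact fun h' => h h'.symm
  rw [map_prod, Finset.prod_apply, Finset.prod_eq_single τ]
  · rcases h1 (s τ) with h | h
    · simp [h]
    · rw [if_neg (by rw [h]; decide), h2, if_pos rfl, h]
  · intro τ' _ hne
    split_ifs
    · simp
    · rw [h2, if_neg hne]
  · simp

theorem index_totallyPositive [IsTotallyReal K] :
    (totallyPositive K).index = 2 ^ Module.finrank ℚ K := by
  have h2 : Nat.card SignTypeˣ = 2 := by
    rw [Nat.card_eq_fintype_card]
    decide
  rw [← ker_signs, Subgroup.index_ker, MonoidHom.range_eq_top.2 signs_surjective,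
    Subgroup.card_top, Nat.card_fun, h2, Nat.card_eq_fintype_card, card_real_embeddings]

theorem exists_unit_sign (h : unitsMulTotallyPositive K = ⊤) (S : Set (K →+* ℝ)) :
    ∃ u : (𝓞 K)ˣ, ∀ τ : K →+* ℝ, (τ ∈ S → τ u < 0) ∧ (τ ∉ S → 0 < τ u) := by
  classical
  obtain ⟨a, ha⟩ := signs_surjective (K := K) fun τ => if τ ∈ S then -1 else 1
  obtain ⟨u, hu⟩ := mem_unitsMulTotallyPositive.1 (h ▸ Subgroup.mem_top a)
  refine ⟨u, fun τ => ⟨fun hτ => ?_, fun hτ => ?_⟩⟩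
  all_goals
    have h1 := congrArg Units.val (congrFun ha τ)
    have h2 := hu τ
    rw [signs_apply] at h1
    simp only [hτ, if_true, if_false, Units.val_neg, Units.val_one] at h1
  · rw [sign_eq_neg_one_iff] at h1
    by_contra h3
    have := mul_nonpos_of_nonneg_of_nonpos (not_lt.1 h3) h1.le
    linarith
  · rw [sign_eq_one_iff] at h1
    exact (pos_iff_pos_of_mul_pos h2).2 h1

/-- Dirichlet's unit theorem bounds the index of the squares of the units. -/
theorem relIndex_squares_dvd [IsTotallyReal K] :
    ((integralUnits K).map (powMonoidHom 2)).relIndex (integralUnits K) ∣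
      2 ^ Module.finrank ℚ K := by
  classical
  let U := (𝓞 K)ˣ
  have hinj : Function.Injective (Units.map (algebraMap (𝓞 K) K : 𝓞 K →* K)) :=
    Units.map_injective RingOfIntegers.coe_injective
  have h1 : ((integralUnits K).map (powMonoidHom 2)).relIndex (integralUnits K) =
      (powMonoidHom 2 : U →* U).range.index := by
    rw [← Subgroup.relIndex_top_right, ← Subgroup.relIndex_map_map_of_injective _ _ hinj,
      integralUnits, MonoidHom.range_eq_map, MonoidHom.range_eq_map, Subgroup.map_map,
      Subgroup.map_map]
    congr 2
  rw [h1, Subgroup.index_eq_card]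
  have : Group.FG (𝓞 K)ˣ := Group.fg_iff_monoid_fg.2 inferInstance
  have : Group.FG (U ⧸ (powMonoidHom 2 : U →* U).range) :=
    Group.fg_of_surjective (QuotientGroup.mk'_surjective _)
  refine (card_dvd_exponent_pow_rank' (n := 2) _ fun g => ?_).trans (pow_dvd_pow 2 ?_)
  · obtain ⟨u, rfl⟩ := QuotientGroup.mk_surjective g
    rw [← QuotientGroup.mk_pow, QuotientGroup.eq_one_iff]
    exact ⟨u, rfl⟩
  -- The units are generated by n - 1 fundamental units and one generator of the torsion, n elements
  -- in all.
  · refine (Group.rank_le_of_surjective _ (QuotientGroup.mk'_surjective _)).trans ?_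
    obtain ⟨g, hg⟩ := IsCyclic.exists_generator (α := Units.torsion K)
    have hS : Subgroup.closure ((insert (g : U) (Finset.univ.image (Units.fundSystem K)) :
        Finset U) : Set U) = ⊤ := by
      rw [eq_top_iff, ← Units.closure_fundSystem_sup_torsion_eq_top, sup_le_iff]
      constructor
      · exact Subgroup.closure_mono (by simp)
      · intro t ht
        obtain ⟨k, hk⟩ := hg ⟨t, ht⟩
        have : t = (g : U) ^ k := congrArg Subtype.val hk.symm
        rw [this]
        exact zpow_mem (Subgroup.subset_closure (by simp)) k
    refine (Group.rank_le hS).trans ((Finset.card_insert_le _ _).trans ?_)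
    refine (Nat.add_le_add_right Finset.card_image_le 1).trans ?_
    rw [Finset.card_univ, Fintype.card_fin, Units.rank, IsTotallyReal.finrank,
      InfinitePlace.card_eq_nrRealPlaces_add_nrComplexPlaces,
      IsTotallyReal.nrComplexPlaces_eq_zero, add_zero]
    have := InfinitePlace.nrRealPlaces K
    have h0 : 0 < Module.finrank ℚ K := Module.finrank_pos
    rw [IsTotallyReal.finrank] at h0
    omega

/-- Compare [U : U²] = [P∩U : U²]·[UP : P], which divides 2^n by Dirichlet, with 2^n = [Kˣ : P] =
[UP : P]·[Kˣ : UP]. Nonvanishing is recorded because an infinite index counts as 0. -/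
theorem relIndex_squares_ne_zero_and_le [IsTotallyReal K] :
    ((integralUnits K).map (powMonoidHom 2)).relIndex (totallyPositive K ⊓ integralUnits K) ≠ 0 ∧
    ((integralUnits K).map (powMonoidHom 2)).relIndex (totallyPositive K ⊓ integralUnits K) ≤
      (unitsMulTotallyPositive K).index := by
  let U := integralUnits K
  let P := totallyPositive K
  have h1 : U.map (powMonoidHom 2) ≤ P ⊓ U := by
    rintro _ ⟨u, hu, rfl⟩
    refine ⟨fun τ => ?_, pow_mem hu 2⟩
    have : τ u ≠ 0 := by simp
    simp only [powMonoidHom_apply, Units.val_pow_eq_pow_val, map_pow]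
    positivity
  have h2 := Subgroup.relIndex_mul_relIndex _ _ U h1 inf_le_right
  rw [Subgroup.inf_relIndex_right, ← Subgroup.relIndex_sup_right U P] at h2
  have h3 := Subgroup.relIndex_mul_index (le_sup_right : P ≤ U ⊔ P)
  have h4 : P.index = _ := index_totallyPositive
  have h5 := Nat.le_of_dvd (by positivity) (relIndex_squares_dvd (K := K))
  have h6 := ne_zero_of_dvd_ne_zero (by positivity) (relIndex_squares_dvd (K := K))
  refine ⟨left_ne_zero_of_mul (h2.trans_ne h6), ?_⟩
  rw [← h4, ← h2, ← h3, mul_comm] at h5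
  refine Nat.le_of_mul_le_mul_left h5 (Nat.pos_of_ne_zero fun h0 => ?_)
  rw [h0, zero_mul, h4] at h3
  exact (by positivity : (2 : ℕ) ^ Module.finrank ℚ K ≠ 0) h3.symm

end SignedUnits

/-! ### Totally positive units modulo squares when the index is 1 or 2 -/

section SignedUnits

variable {K : Type*} [Field K] [NumberField K] [IsTotallyReal K]

omit [NumberField K] [IsTotallyReal K] in
theorem mem_map_powMonoidHom_integralUnits {a : Kˣ} :
    a ∈ (integralUnits K).map (powMonoidHom 2) ↔ ∃ v : (𝓞 K)ˣ, (a : K) = (v : K) ^ 2 := by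
  constructor
  · rintro ⟨_, ⟨v, rfl⟩, rfl⟩
    exact ⟨v, rfl⟩
  · rintro ⟨v, hv⟩
    exact ⟨_, ⟨v, rfl⟩, Units.ext hv.symm⟩

omit [NumberField K] [IsTotallyReal K] in
theorem map_mem_totallyPositive_inf {u : (𝓞 K)ˣ} (hu : ∀ τ : K →+* ℝ, 0 < τ u) :
    Units.map (algebraMap (𝓞 K) K : 𝓞 K →* K) u ∈ totallyPositive K ⊓ integralUnits K :=
  ⟨hu, ⟨u, rfl⟩⟩

theorem exists_eq_sq_of_eq_top (h : unitsMulTotallyPositive K = ⊤) (u : (𝓞 K)ˣ)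
    (hu : ∀ τ : K →+* ℝ, 0 < τ u) : ∃ v : (𝓞 K)ˣ, (u : K) = (v : K) ^ 2 := by
  obtain ⟨h1, h2⟩ := relIndex_squares_ne_zero_and_le (K := K)
  rw [h, Subgroup.index_top] at h2
  have h3 := Subgroup.relIndex_eq_one.1 (le_antisymm h2 (Nat.one_le_iff_ne_zero.2 h1))
  exact mem_map_powMonoidHom_integralUnits.1 (h3 (map_mem_totallyPositive_inf hu))

theorem exists_eq_mul_sq_of_index_eq_two (h : (unitsMulTotallyPositive K).index = 2)
    (u w : (𝓞 K)ˣ) (hu : ∀ τ : K →+* ℝ, 0 < τ u) (hw : ∀ τ : K →+* ℝ, 0 < τ w)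
    (hw' : ¬ ∃ v : (𝓞 K)ˣ, (w : K) = (v : K) ^ 2) :
    ∃ v : (𝓞 K)ˣ, (u : K) = (v : K) ^ 2 ∨ (u : K) = w * (v : K) ^ 2 := by
  obtain ⟨h1, h2⟩ := relIndex_squares_ne_zero_and_le (K := K)
  rw [h] at h2
  set Q := (integralUnits K).map (powMonoidHom 2)
  set P := totallyPositive K ⊓ integralUnits K
  have hu' := map_mem_totallyPositive_inf hu
  have hw'' := map_mem_totallyPositive_inf hw
  have h3 : Q.relIndex P = 2 := by
    refine le_antisymm h2 ?_
    by_contra hlt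
    have h4 : Q.relIndex P = 1 := by omega
    exact hw' (mem_map_powMonoidHom_integralUnits.1 (Subgroup.relIndex_eq_one.1 h4 hw''))
  have h5 := Subgroup.mul_mem_iff_of_index_two (H := Q.subgroupOf P) h3
    (a := ⟨_, hu'⟩) (b := ⟨_, hw''⟩)
  simp only [Subgroup.mem_subgroupOf, Subgroup.coe_mul, Q] at h5
  rw [mem_map_powMonoidHom_integralUnits, mem_map_powMonoidHom_integralUnits,
    mem_map_powMonoidHom_integralUnits] at h5
  by_cases hsq : ∃ v : (𝓞 K)ˣ, (u : K) = (v : K) ^ 2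
  · obtain ⟨v, hv⟩ := hsq
    exact ⟨v, Or.inl hv⟩
  · obtain ⟨v, hv⟩ := h5.2 (iff_of_false hsq hw')
    refine ⟨v * w⁻¹, Or.inr ?_⟩
    have hv' : (u : K) * w = (v : K) ^ 2 := hv
    have hne : (w : K) ≠ 0 := by simp
    have hinv : ((w⁻¹ : (𝓞 K)ˣ) : K) = (w : K)⁻¹ := by
      rw [← mul_eq_one_iff_eq_inv₀ hne, ← map_mul, Units.inv_mul, map_one]
    rw [Units.val_mul, map_mul, hinv, mul_pow, ← hv']
    field_simp

theorem odd_card_filter_of_prod_neg {ι : Type*} (s : Finset ι) (f : ι → ℝ)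
    (h : ∏ i ∈ s, f i < 0) : Odd (s.filter fun i => f i < 0).card := by
  classical
  have key : ∀ s : Finset ι, (∏ i ∈ s, f i < 0 → Odd (s.filter fun i => f i < 0).card) ∧
      (0 < ∏ i ∈ s, f i → Even (s.filter fun i => f i < 0).card) := by
    intro s
    induction s using Finset.induction_on with
    | empty => simp
    | insert i s hi ih =>
      have hni : i ∉ s.filter fun i => f i < 0 := fun h => hi (Finset.mem_filter.1 h).1
      rw [Finset.prod_insert hi, Finset.filter_insert]
      rcases lt_trichotomy (f i) 0 with h | h | h
      · rw [if_pos h, Finset.card_insert_of_notMem hni, Nat.odd_add_one, Nat.even_add_one,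
          Nat.not_odd_iff_even, Nat.not_even_iff_odd]
        exact ⟨fun h' => ih.2 ((neg_iff_pos_of_mul_neg h').1 h),
          fun h' => ih.1 ((neg_iff_neg_of_mul_pos h').1 h)⟩
      · simp [h]
      · rw [if_neg h.not_gt]
        exact ⟨fun h' => ih.1 ((pos_iff_neg_of_mul_neg h').1 h),
          fun h' => ih.2 ((pos_iff_pos_of_mul_pos h').1 h)⟩
  exact (key s).1 h

omit [IsTotallyReal K] in
theorem map_mem_unitsMulTotallyPositive (σ : Gal(K/ℚ)) {a : Kˣ}
    (ha : a ∈ unitsMulTotallyPositive K) :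
    Units.map (σ : K →* K) a ∈ unitsMulTotallyPositive K := by
  obtain ⟨u, hu⟩ := mem_unitsMulTotallyPositive.1 ha
  refine mem_unitsMulTotallyPositive.2
    ⟨Units.mapEquiv (RingOfIntegers.mapRingEquiv (σ : K ≃+* K)).toMulEquiv u, fun τ => ?_⟩
  exact hu (τ.comp (σ : K →+* K))

/-- In a totally real Galois field with a unit of norm `-1`, the signatures of the units do not
form a subgroup of index two. -/
theorem index_ne_two_of_norm_eq_neg_one [IsGalois ℚ K] (κ : (𝓞 K)ˣ)
    (hκ : Algebra.norm ℚ (κ : K) = -1) : (unitsMulTotallyPositive K).index ≠ 2 := by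
  classical
  intro hH
  set H := unitsMulTotallyPositive K
  have hne : Nonempty (K →+* ℝ) := by
    rw [← Fintype.card_pos_iff, card_real_embeddings]
    exact Module.finrank_pos
  obtain ⟨τ₀⟩ := hne
  obtain ⟨a, ha⟩ := exists_neg_iff_eq τ₀
  let g : Gal(K/ℚ) → (K →+* ℝ) := fun σ => τ₀.comp (σ : K →+* K)
  have hginj : Function.Injective g := fun σ σ' h => by
    ext x
    exact τ₀.injective (RingHom.congr_fun h x)
  have hgbij : Function.Bijective g := by
    rw [Fintype.bijective_iff_injective_and_card]
    exact ⟨hginj, by rw [card_real_embeddings, ← Nat.card_eq_fintype_card,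
      IsGalois.card_aut_eq_finrank]⟩
  let S : K → Finset Gal(K/ℚ) := fun b => Finset.univ.filter fun σ => τ₀ (σ b) < 0
  let c : Gal(K/ℚ) → Kˣ := fun σ => Units.map ((σ⁻¹ : Gal(K/ℚ)) : K →* K) a
  have hc : ∀ ρ σ, g ρ (c σ) < 0 ↔ σ = ρ := by
    intro ρ σ
    have h1 : g ρ (c σ) = g (ρ * σ⁻¹) a := rfl
    have h2 : τ₀ = g 1 := rfl
    rw [h1, ha, h2, hginj.eq_iff, mul_inv_eq_one, eq_comm]
  -- Each c σ is a conjugate of a, negative at exactly one place; multiplying b by those at its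
  -- negative places makes it totally positive.
  have hpos : ∀ b : Kˣ, b * ∏ σ ∈ S b, c σ ∈ H := by
    intro b
    refine (le_sup_right : totallyPositive K ≤ H) fun τ => ?_
    obtain ⟨ρ, rfl⟩ := hgbij.2 τ
    rw [Units.val_mul, map_mul, Units.coe_prod, map_prod]
    have h1 : ∀ σ, σ ≠ ρ → 0 < g ρ (c σ) := fun σ hσ =>
      lt_of_le_of_ne (not_lt.1 (mt (hc ρ σ).1 hσ)) (Ne.symm (by simp))
    by_cases hρ : ρ ∈ S b
    · rw [← Finset.mul_prod_erase _ _ hρ, ← mul_assoc]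
      refine mul_pos (mul_pos_of_neg_of_neg (Finset.mem_filter.1 hρ).2 ((hc ρ ρ).2 rfl)) ?_
      exact Finset.prod_pos fun σ hσ => h1 σ (Finset.ne_of_mem_erase hσ)
    · have h2 : 0 < g ρ b := by
        refine lt_of_le_of_ne (not_lt.1 fun h => hρ ?_) (Ne.symm (by simp))
        exact Finset.mem_filter.2 ⟨Finset.mem_univ _, h⟩
      exact mul_pos h2 (Finset.prod_pos fun σ hσ => h1 σ (by rintro rfl; exact hρ hσ))
  by_cases haH : a ∈ H
  · have htop : H = ⊤ := by
      rw [Subgroup.eq_top_iff']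
      intro b
      exact (Subgroup.mul_mem_cancel_right _
        (prod_mem fun σ _ => map_mem_unitsMulTotallyPositive _ haH)).1 (hpos b)
    rw [htop, Subgroup.index_top] at hH
    omega
  -- Here no conjugate of a lies in H, so in index 2 membership in H means an even number of
  -- negative signs. A unit of norm -1 lies in H but has an odd number.
  · have hcH : ∀ σ, c σ ∉ H := by
      intro σ h
      have := map_mem_unitsMulTotallyPositive σ h
      have h2 : Units.map (σ : K →* K) (c σ) = a := Units.ext (σ.apply_symm_apply _)
      rw [h2] at this
      exact haH this
    have heven : ∀ s : Finset Gal(K/ℚ), ∏ σ ∈ s, c σ ∈ H ↔ Even s.card := by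
      intro s
      induction s using Finset.induction_on with
      | empty => simp
      | insert σ s hσ ih =>
        rw [Finset.prod_insert hσ, Finset.card_insert_of_notMem hσ,
          Subgroup.mul_mem_iff_of_index_two hH, ih, Nat.even_add_one]
        simp [hcH σ]
    let k : Kˣ := Units.map (algebraMap (𝓞 K) K : 𝓞 K →* K) κ
    have hk : k ∈ H := (le_sup_left : integralUnits K ≤ H) ⟨κ, rfl⟩
    have h1 := (heven _).1 ((Subgroup.mul_mem_cancel_left _ hk).1 (hpos k))
    refine Nat.not_odd_iff_even.2 h1 (odd_card_filter_of_prod_neg _ _ ?_)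
    have h2 := congrArg τ₀ (Algebra.norm_eq_prod_automorphisms ℚ (κ : K))
    rw [hκ, map_prod] at h2
    change ∏ σ : Gal(K/ℚ), τ₀ (σ (κ : K)) < 0
    rw [← h2]
    simp

end SignedUnits

/-! ### Norms from cyclotomic units for m not a prime power -/

section Cyclotomic

open scoped ComplexConjugate

variable {F : Type*} [Field F] [NumberField F]

theorem isCyclotomicExtension_of_two_mul_odd {k : ℕ} (hk : Odd k)
    [h : IsCyclotomicExtension {2 * k} ℚ F] : IsCyclotomicExtension {k} ℚ F := by
  have h0 : k ≠ 0 := hk.pos.ne'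
  rw [IsCyclotomicExtension.iff_adjoin_eq_top] at h ⊢
  obtain ⟨h1, h2⟩ := h
  refine ⟨fun n hn _ => ?_, ?_⟩
  · obtain ⟨r, hr⟩ := h1 (2 * k) rfl (by omega)
    rw [Set.mem_singleton_iff.1 hn]
    exact ⟨r ^ 2, hr.pow (by omega) rfl⟩
  · rw [eq_top_iff, ← h2, Algebra.adjoin_le_iff]
    rintro b ⟨n, hn, -, hb⟩
    rw [Set.mem_singleton_iff.1 hn, mul_comm, pow_mul, sq_eq_one_iff] at hb
    rcases hb with hb | hb
    · exact Algebra.subset_adjoin ⟨k, rfl, h0, hb⟩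
    · rw [← neg_neg b]
      refine neg_mem (Algebra.subset_adjoin ⟨k, rfl, h0, ?_⟩)
      rw [hk.neg_pow, hb, neg_neg]

variable [IsCMField F]

theorem complexConj_of_pow_eq_one {x : F} {m : ℕ} (hm : m ≠ 0) (hx : x ^ m = 1) :
    IsCMField.complexConj F x = x⁻¹ := by
  obtain ⟨φ⟩ : Nonempty (F →+* ℂ) := inferInstance
  apply φ.injective
  rw [IsCMField.complexEmbedding_complexConj, map_inv₀]
  refine (Complex.inv_eq_conj ?_).symm
  exact Complex.norm_eq_one_of_pow_eq_one (by rw [← map_pow, hx, map_one]) hm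

omit [NumberField F] [IsCMField F] in
theorem ofReal_eq_of_comp_eq {τ : maximalRealSubfield F →+* ℝ} {φ : F →+* ℂ}
    (h : φ.comp (algebraMap (maximalRealSubfield F) F) = Complex.ofRealHom.comp τ)
    (x : maximalRealSubfield F) : ((τ x : ℝ) : ℂ) = φ (x : F) :=
  (RingHom.congr_fun h x).symm

theorem exists_comp_eq_ofReal (τ : maximalRealSubfield F →+* ℝ) :
    ∃ φ : F →+* ℂ, φ.comp (algebraMap (maximalRealSubfield F) F) = Complex.ofRealHom.comp τ :=
  ⟨_, ComplexEmbedding.lift_comp_algebraMap F (Complex.ofRealHom.comp τ)⟩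

theorem pos_of_coe_eq_mul_complexConj {x : maximalRealSubfield F} {w : F} (hw : w ≠ 0)
    (h : (x : F) = w * IsCMField.complexConj F w) (τ : maximalRealSubfield F →+* ℝ) :
    0 < τ x := by
  obtain ⟨φ, hφ⟩ := exists_comp_eq_ofReal τ
  have h1 := ofReal_eq_of_comp_eq hφ x
  rw [h, map_mul, IsCMField.complexEmbedding_complexConj, Complex.mul_conj] at h1
  rw [Complex.ofReal_injective h1]
  exact Complex.normSq_pos.2 (by simpa using hw)

theorem exists_unit_coe_eq_mul_complexConj (w : (𝓞 F)ˣ) :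
    ∃ v : (𝓞 (maximalRealSubfield F))ˣ,
      ((v : maximalRealSubfield F) : F) = w * IsCMField.complexConj F w := by
  let w' : (𝓞 F)ˣ := IsCMField.unitsComplexConj F w
  have h1 : ((w * w' : (𝓞 F)ˣ) : F) = w * IsCMField.complexConj F w := rfl
  obtain ⟨v, hv⟩ := (IsCMField.Units.complexConj_eq_self_iff F (w * w')).1 (by
    rw [h1, map_mul, IsCMField.complexConj_apply_apply, mul_comm])
  exact ⟨v, hv.trans h1⟩

/-- If `m` is not a prime power, then the norm of `1 - ζ_m` is not the square of a real unit. -/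
theorem exists_nonsquare_norm {m : ℕ} (hm : 2 < m) (hm4 : Odd m ∨ 4 ∣ m)
    [IsCyclotomicExtension {m} ℚ F] (hpp : ∀ {p : ℕ}, Nat.Prime p → ∀ k : ℕ, p ^ k ≠ m) :
    ∃ (w : (𝓞 F)ˣ) (v : (𝓞 (maximalRealSubfield F))ˣ),
      ((v : maximalRealSubfield F) : F) = w * IsCMField.complexConj F w ∧
      ¬ ∃ t : (𝓞 (maximalRealSubfield F))ˣ,
        (v : maximalRealSubfield F) = (t : maximalRealSubfield F) ^ 2 := by
  have : NeZero m := NeZero.of_gt hm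
  have hζ := IsCyclotomicExtension.zeta_spec m ℚ F
  set ζ := IsCyclotomicExtension.zeta m ℚ F
  have hnorm := hζ.norm_toInteger_sub_one_eq_one hm hpp
  have hu : IsUnit (hζ.toInteger - 1) := by
    rw [NumberField.isUnit_iff_norm, RingOfIntegers.coe_norm, ← Algebra.coe_norm_int, hnorm]
    simp
  obtain ⟨w, hw⟩ := hu
  have hw' : (w : F) = ζ - 1 := by
    rw [hw]
    rfl
  have hζ0 : ζ ≠ 0 := hζ.ne_zero (NeZero.ne m)
  obtain ⟨v, hv⟩ := exists_unit_coe_eq_mul_complexConj w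
  refine ⟨w, v, hv, ?_⟩
  rintro ⟨t, ht⟩
  have ht0 : ((t : maximalRealSubfield F) : F) ≠ 0 := by
    have : (t : maximalRealSubfield F) ≠ 0 := by simp
    exact_mod_cast this
  -- If (ζ-1)(ζ⁻¹-1) = t², then s² = (ζ-1)/(ζ⁻¹-1) = -ζ, so s is a root of unity. Its order does not
  -- divide the number of roots of unity in F, which is 2m for odd m and m for even m.
  set s : F := (ζ - 1) / ((t : maximalRealSubfield F) : F)
  have hs : s ^ 2 = -ζ := by
    rw [ht, hw', map_sub, map_one, complexConj_of_pow_eq_one (NeZero.ne m) hζ.pow_eq_one] at hv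
    have hv' : ((t : maximalRealSubfield F) : F) ^ 2 = (ζ - 1) * (ζ⁻¹ - 1) := hv
    rw [div_pow, div_eq_iff (pow_ne_zero 2 ht0), hv']
    field_simp
    ring
  have hs1 : s ^ (4 * m) = 1 := by
    rw [show 4 * m = 2 * (2 * m) by ring, pow_mul, hs, pow_mul, neg_sq, ← pow_mul, mul_comm,
      pow_mul, hζ.pow_eq_one, one_pow]
  have hord : 0 < orderOf s := orderOf_pos_iff.2 (isOfFinOrder_iff_pow_eq_one.2
    ⟨4 * m, by omega, hs1⟩)
  have : NeZero (orderOf s) := ⟨hord.ne'⟩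
  have hdvd := NumberField.Units.dvd_torsionOrder_of_isPrimitiveRoot (IsPrimitiveRoot.orderOf s)
  have hpow := orderOf_dvd_iff_pow_eq_one.1 hdvd
  rw [IsCyclotomicExtension.Rat.torsionOrder_eq (n := m)] at hpow
  rcases hm4 with hodd | h4
  · rw [if_neg (Nat.not_even_iff_odd.2 hodd), pow_mul, hs, hodd.neg_pow, hζ.pow_eq_one] at hpow
    norm_num at hpow
  · obtain ⟨k, rfl⟩ := h4
    rw [if_pos ⟨2 * k, by ring⟩, show 4 * k = 2 * (2 * k) by ring, pow_mul, hs,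
      (even_two_mul k).neg_pow] at hpow
    exact hζ.pow_ne_one_of_pos_of_lt (by omega) (by omega) hpow

end Cyclotomic

/-! ### Quotients of sines and units of norm -1 -/

section Cyclotomic

variable {F : Type*} [Field F] [NumberField F]

/-- The element `ζ^{-(c-1)/2} (1 - ζ^c)` for odd `c`, which is `ζ^{1/2}` times the antisymmetric
element `ζ^{-c/2} - ζ^{c/2}`. -/
def halfSine (ζ : F) (c : ℕ) : F := ζ⁻¹ ^ (c / 2) * (1 - ζ ^ c)

variable {ζ : F} {m : ℕ}

theorem map_halfSine (σ : Gal(F/ℚ)) {g c : ℕ} (hg : Odd g) (hc : Odd c) (hζ : ζ ≠ 0)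
    (hσ : σ ζ = ζ ^ g) : σ (halfSine ζ c) = ζ ^ (g / 2) * halfSine ζ (g * c) := by
  obtain ⟨a, rfl⟩ := hg
  obtain ⟨b, rfl⟩ := hc
  have h1 : (2 * a + 1) / 2 = a := by omega
  have h2 : (2 * b + 1) / 2 = b := by omega
  have h3 : ((2 * a + 1) * (2 * b + 1)) / 2 = (2 * a + 1) * b + a := by
    rw [show (2 * a + 1) * (2 * b + 1) = 2 * ((2 * a + 1) * b + a) + 1 by ring]
    omega
  rw [halfSine, halfSine, h1, h2, h3, map_mul, map_pow, map_inv₀, map_sub, map_pow, map_one, hσ,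
    pow_add ζ⁻¹, ← pow_mul ζ, ← inv_pow, ← pow_mul ζ⁻¹]
  have h4 : ζ ^ a * ζ⁻¹ ^ a = 1 := by rw [← mul_pow, mul_inv_cancel₀ hζ, one_pow]
  linear_combination (-ζ⁻¹ ^ ((2 * a + 1) * b) * (1 - ζ ^ ((2 * a + 1) * (2 * b + 1)))) * h4

theorem complexConj_halfSine [IsCMField F] (hζ : ζ ≠ 0)
    (hζ' : IsCMField.complexConj F ζ = ζ⁻¹) {c : ℕ} (hc : Odd c) :
    IsCMField.complexConj F (halfSine ζ c) = -ζ⁻¹ * halfSine ζ c := by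
  obtain ⟨b, rfl⟩ := hc
  have h2 : (2 * b + 1) / 2 = b := by omega
  rw [halfSine, h2, map_mul, map_pow, map_inv₀, map_sub, map_pow, map_one, hζ', inv_inv]
  simp only [inv_pow, pow_succ, pow_mul']
  field_simp
  ring

omit [NumberField F] in
theorem halfSine_ne_zero (hζ : IsPrimitiveRoot ζ m) (hm : 1 < m) {c : ℕ} (hc : c.Coprime m) :
    halfSine ζ c ≠ 0 := by
  refine mul_ne_zero (pow_ne_zero _ (inv_ne_zero (hζ.ne_zero (by omega)))) ?_
  rw [sub_ne_zero, ne_comm, ne_eq, hζ.pow_eq_one_iff_dvd]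
  intro h
  have := Nat.Coprime.eq_one_of_dvd hc.symm h
  omega

theorem prod_range_succ_div {K : Type*} [Field K] {f : ℕ → K} (hf : ∀ i, f i ≠ 0) (n : ℕ) :
    ∏ i ∈ Finset.range n, f (i + 1) / f i = f n / f 0 := by
  induction n with
  | zero => simp [hf 0]
  | succ n ih => rw [Finset.prod_range_succ, ih, mul_comm, div_mul_div_cancel₀ (hf n)]

/-- The unit is κ = h(g)/h(1), where h = `halfSine ζ`. Modulo conjugation σ : ζ ↦ ζ^g generates the
Galois group, and σ^i κ = h(g^(i+1))/h(g^i), so the norm telescopes to h(g^n)/h(1) = -1. -/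
theorem exists_unit_norm_eq_neg_one_of_generator [IsCMField F] (hζ : IsPrimitiveRoot ζ m)
    (hm : 1 < m) [IsCyclotomicExtension {m} ℚ F] {g : ℕ} (hg : Odd g) (hgm : g.Coprime m)
    (hgen : ∀ a : (ZMod m)ˣ, ∃ j : ℕ, a = ZMod.unitOfCoprime g hgm ^ j ∨
      a = -ZMod.unitOfCoprime g hgm ^ j)
    (hend : halfSine ζ (g ^ Module.finrank ℚ (maximalRealSubfield F)) = -halfSine ζ 1) :
    ∃ κ : (𝓞 (maximalRealSubfield F))ˣ,
      Algebra.norm ℚ (κ : maximalRealSubfield F) = -1 := by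
  classical
  have : NeZero m := NeZero.of_gt hm
  have hζ0 : ζ ≠ 0 := hζ.ne_zero (NeZero.ne m)
  have hζm : ζ ^ m = 1 := hζ.pow_eq_one
  have hζ' := complexConj_of_pow_eq_one (NeZero.ne m) hζm
  have : IsAbelianGalois ℚ F := IsCyclotomicExtension.isAbelianGalois {m} ℚ F
  have : IsAbelianGalois ℚ (maximalRealSubfield F) :=
    IsAbelianGalois.tower_bot ℚ (maximalRealSubfield F) F
  let e := IsCyclotomicExtension.Rat.galEquivZMod m F
  have he : ∀ σ, σ ζ = ζ ^ (e σ).val.val := fun σ =>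
    IsCyclotomicExtension.Rat.galEquivZMod_apply_of_pow_eq m F σ hζm
  have hext : ∀ σ τ : Gal(F/ℚ), σ ζ = τ ζ → σ = τ := fun σ τ h => by
    rw [he, he] at h
    apply e.injective
    ext1
    exact ZMod.val_injective m (hζ.pow_inj (ZMod.val_lt _) (ZMod.val_lt _) h)
  let γ := ZMod.unitOfCoprime g hgm
  let σ : Gal(F/ℚ) := e.symm γ
  have hσ : σ ζ = ζ ^ g := by
    rw [he, e.apply_symm_apply, ZMod.coe_unitOfCoprime, ZMod.val_natCast, ← pow_mod_orderOf,
      ← hζ.eq_orderOf, Nat.mod_mod, hζ.eq_orderOf, pow_mod_orderOf]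
  let c : Gal(F/ℚ) := (IsCMField.complexConj F).restrictScalars ℚ
  have hc : e c = -1 := by
    rw [← e.apply_symm_apply (-1)]
    congr 1
    refine hext _ _ ?_
    change IsCMField.complexConj F ζ = _
    rw [hζ', he, e.apply_symm_apply]
    refine inv_eq_of_mul_eq_one_right ?_
    rw [← pow_succ',
      hζ.pow_eq_one_iff_dvd, ← ZMod.natCast_eq_zero_iff]
    simp
  have hcop : ∀ i, (g ^ i).Coprime m := fun i => Nat.Coprime.pow_left i hgm
  have hne : ∀ i, halfSine ζ (g ^ i) ≠ 0 := fun i => halfSine_ne_zero hζ hm (hcop i)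
  set k₀ : F := halfSine ζ (g ^ 1) / halfSine ζ (g ^ 0) with hk₀
  have hσk : ∀ i : ℕ, (σ ^ i) k₀ = halfSine ζ (g ^ (i + 1)) / halfSine ζ (g ^ i) := by
    intro i
    induction i with
    | zero => rfl
    | succ i ih =>
      rw [pow_succ', AlgEquiv.mul_apply, ih, map_div₀, map_halfSine σ hg hg.pow hζ0 hσ,
        map_halfSine σ hg hg.pow hζ0 hσ, ← pow_succ', ← pow_succ',
        mul_div_mul_left _ _ (pow_ne_zero _ hζ0)]
  have hck : IsCMField.complexConj F k₀ = k₀ := by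
    rw [hk₀, map_div₀, complexConj_halfSine hζ0 hζ' hg.pow, complexConj_halfSine hζ0 hζ' hg.pow,
      mul_div_mul_left _ _ (neg_ne_zero.2 (inv_ne_zero hζ0))]
  have hint : IsIntegral ℤ k₀ := by
    have h1 : ζ ≠ 1 := hζ.ne_one hm
    -- The quotient (1 - ζ^g)/(1 - ζ) is a geometric sum, which shows integrality; that it is a unit
    -- follows later from its norm.
    have h2 : k₀ = ζ⁻¹ ^ (g / 2) * ∑ i ∈ Finset.range g, ζ ^ i := by
      rw [hk₀, geom_sum_eq h1, halfSine, halfSine, pow_one, pow_zero, pow_one]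
      have h3 : 1 - ζ ≠ 0 := sub_ne_zero.2 h1.symm
      have h4 : ζ - 1 ≠ 0 := sub_ne_zero.2 h1
      rw [show 1 / 2 = 0 from rfl, pow_zero, one_mul]
      field_simp
      ring
    have h3 : IsIntegral ℤ ζ := hζ.isIntegral (by omega)
    have h4 : IsIntegral ℤ ζ⁻¹ := hζ.inv.isIntegral (by omega)
    rw [h2]
    exact (h4.pow _).mul (IsIntegral.sum _ fun i _ => h3.pow i)
  obtain ⟨k, hk⟩ := (IsCMField.RingOfIntegers.complexConj_eq_self_iff F ⟨k₀, hint⟩).1 hck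
  have hk' : ((k : maximalRealSubfield F) : F) = k₀ := hk
  let K := maximalRealSubfield F
  let r : Gal(F/ℚ) →* Gal(K/ℚ) := AlgEquiv.restrictNormalHom K
  have hr : ∀ (τ : Gal(F/ℚ)) (x : K), ((r τ x : K) : F) = τ x := fun τ x =>
    AlgEquiv.restrictNormal_commutes τ K x
  have hrc : r c = 1 := by
    ext x
    rw [hr]
    exact IsCMField.complexConj_apply_eq_self F x
  have hcyc : ∀ τ : Gal(K/ℚ), τ ∈ Subgroup.zpowers (r σ) := by
    intro τ
    obtain ⟨τ', rfl⟩ := AlgEquiv.restrictNormalHom_surjective (F := ℚ) (K₁ := K) F τ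
    obtain ⟨j, hj⟩ := hgen (e τ')
    refine ⟨j, ?_⟩
    change r σ ^ (j : ℤ) = r τ'
    rw [zpow_natCast, ← map_pow]
    rcases hj with hj | hj
    · congr 1
      apply e.injective
      rw [hj, map_pow, e.apply_symm_apply]
    · rw [← mul_one (r (σ ^ j)), ← hrc, ← map_mul]
      congr 1
      apply e.injective
      rw [hj, map_mul, map_pow, e.apply_symm_apply, hc, mul_neg, mul_one]
  have hord : orderOf (r σ) = Module.finrank ℚ K := by
    rw [orderOf_eq_card_of_forall_mem_zpowers hcyc, IsGalois.card_aut_eq_finrank]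
  have hnorm : Algebra.norm ℚ (k : K) = -1 := by
    have h1 := congrArg (algebraMap K F) (Algebra.norm_eq_prod_automorphisms ℚ (k : K))
    rw [← IsCyclic.image_range_orderOf hcyc, Finset.prod_image (fun i hi j hj h =>
      pow_injOn_Iio_orderOf (by simpa using hi) (by simpa using hj) h), map_prod] at h1
    have h2 : ∀ i, algebraMap K F ((r σ ^ i) (k : K)) =
        halfSine ζ (g ^ (i + 1)) / halfSine ζ (g ^ i) := fun i => by
      rw [← hσk, ← hk', ← map_pow]
      exact hr _ _
    rw [Finset.prod_congr rfl fun i _ => h2 i, prod_range_succ_div hne,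
      hord, hend, pow_zero, neg_div, div_self (by simpa using hne 0)] at h1
    have h3 : algebraMap K F (algebraMap ℚ K (Algebra.norm ℚ (k : K))) =
        algebraMap K F (algebraMap ℚ K (-1)) := by rw [h1]; simp
    exact (algebraMap ℚ K).injective ((algebraMap K F).injective h3)
  have hunit : IsUnit k := by
    rw [NumberField.isUnit_iff_norm, RingOfIntegers.coe_norm, hnorm]
    simp
  exact ⟨hunit.unit, hnorm⟩

end Cyclotomic

/-! ### Generators of the unit group modulo prime powers -/

section Cyclotomic

variable {F : Type*} [Field F] [NumberField F]

theorem pow_half_order_eq_neg_one {R : Type*} [CommRing R] [Finite Rˣ]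
    (hR : (-1 : Rˣ) ≠ 1) {u : Rˣ} (hu : ∀ a : Rˣ, a ∈ Subgroup.zpowers u) {n : ℕ}
    (hcard : Nat.card Rˣ = 2 * n) : u ^ n = -1 := by
  have hord : orderOf u = 2 * n := by rw [orderOf_eq_card_of_forall_mem_zpowers hu, hcard]
  have h1 : (u ^ n) ^ 2 = 1 := by rw [← pow_mul, mul_comm, ← hord, pow_orderOf_eq_one]
  obtain ⟨j, hj⟩ := hu (-1)
  have hj' : u ^ j = -1 := hj
  have h2 : u ^ (2 * j) = 1 := by rw [mul_comm, zpow_mul, hj']; norm_num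
  rw [← orderOf_dvd_iff_zpow_eq_one, hord, Nat.cast_mul, Nat.cast_two] at h2
  obtain ⟨i, rfl⟩ := Int.dvd_of_mul_dvd_mul_left two_ne_zero h2
  rw [zpow_mul, zpow_natCast] at hj'
  rcases Int.even_or_odd i with ⟨l, rfl⟩ | ⟨l, rfl⟩
  · rw [← two_mul, zpow_mul, zpow_ofNat, h1, one_zpow] at hj'
    exact absurd hj'.symm hR
  · rwa [zpow_add, zpow_mul, zpow_ofNat, h1, one_zpow, one_mul, zpow_one] at hj'

variable {ζ : F} {m : ℕ}

omit [NumberField F] in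
-- Up to a factor independent of c this is ζ^(-c/2) - ζ^(c/2), which is odd in c and has period 2m;
-- hence the modulus 2m.
theorem halfSine_of_two_mul_dvd (hζ : IsPrimitiveRoot ζ m) (hm : m ≠ 0) {c : ℕ}
    (hc : 2 * m ∣ c + 1) : halfSine ζ c = -halfSine ζ 1 := by
  obtain ⟨s, hs⟩ := hc
  have hs0 : 0 < m * s := by
    rw [mul_assoc] at hs
    omega
  obtain ⟨t, ht⟩ : ∃ t, m * s = t + 1 := ⟨m * s - 1, by omega⟩
  have hc' : c = 2 * t + 1 := by rw [mul_assoc] at hs; omega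
  have h1 : ζ ^ (t + 1) = 1 := by rw [← ht, pow_mul, hζ.pow_eq_one, one_pow]
  have hζ0 := hζ.ne_zero hm
  have h2 : ζ⁻¹ ^ t = ζ := by
    rw [inv_pow]
    exact inv_eq_of_mul_eq_one_left (by rw [← pow_succ', h1])
  have h3 : ζ ^ c = ζ⁻¹ := by
    apply eq_inv_of_mul_eq_one_left
    rw [← pow_succ, hc', show 2 * t + 1 + 1 = (t + 1) * 2 by ring, pow_mul, h1, one_pow]
  rw [halfSine, halfSine, show c / 2 = t by omega, h2, h3]
  simp [mul_sub, hζ0]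

omit [NumberField F] in
-- A shift of c by the order 2m of ζ is half a period and changes the sign.
theorem halfSine_of_eq_add (hζ : IsPrimitiveRoot ζ (2 * m)) (hm : m ≠ 0) {c s : ℕ}
    (hc : c = 1 + 2 * m + 4 * m * s) : halfSine ζ c = -halfSine ζ 1 := by
  have h1 : ζ ^ m = -1 := by
    have h2 : (ζ ^ m) ^ 2 = 1 := by rw [← pow_mul, mul_comm, hζ.pow_eq_one]
    refine (sq_eq_one_iff.1 h2).resolve_left ?_
    exact hζ.pow_ne_one_of_pos_of_lt hm (by omega)
  have hc2 : c / 2 = m + 2 * m * s := by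
    rw [hc, show 1 + 2 * m + 4 * m * s = 2 * (m + 2 * m * s) + 1 by ring]
    omega
  have h3 : ζ⁻¹ ^ (m + 2 * m * s) = -1 := by
    rw [inv_pow, pow_add, pow_mul, hζ.pow_eq_one, one_pow, h1]
    norm_num
  have h4 : ζ ^ c = ζ := by
    rw [hc, show 1 + 2 * m + 4 * m * s = 2 * m * (1 + 2 * s) + 1 by ring, pow_succ, pow_mul,
      hζ.pow_eq_one, one_pow, one_mul]
  rw [halfSine, halfSine, hc2, h3, h4]
  simp

variable [IsCMField F]

theorem two_mul_finrank_maximalRealSubfield [NeZero m] [IsCyclotomicExtension {m} ℚ F] :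
    2 * Module.finrank ℚ (maximalRealSubfield F) = m.totient := by
  rw [← CMType.finrank_eq_two_mul, IsCyclotomicExtension.Rat.finrank m F]

theorem exists_unit_norm_eq_neg_one_of_odd (hm : 2 < m) (hodd : Odd m)
    (hcyc : IsCyclic (ZMod m)ˣ) [IsCyclotomicExtension {m} ℚ F] :
    ∃ κ : (𝓞 (maximalRealSubfield F))ˣ,
      Algebra.norm ℚ (κ : maximalRealSubfield F) = -1 := by
  have : NeZero m := NeZero.of_gt hm
  have : Fact (2 < m) := ⟨hm⟩
  have hζ := IsCyclotomicExtension.zeta_spec m ℚ F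
  obtain ⟨u, hu⟩ := IsCyclic.exists_generator (α := (ZMod m)ˣ)
  -- As m is odd, adding it fixes the parity of a representative; an odd g lifts g^n ≡ -1 from
  -- modulus m to modulus 2m.
  obtain ⟨g, hg, hgu⟩ : ∃ g : ℕ, Odd g ∧ (g : ZMod m) = u := by
    have h : ((u.val.val : ℕ) : ZMod m) = u := ZMod.natCast_zmod_val _
    rcases Nat.even_or_odd u.val.val with he | ho
    · exact ⟨u.val.val + m, he.add_odd hodd, by rw [Nat.cast_add, h, ZMod.natCast_self, add_zero]⟩
    · exact ⟨_, ho, h⟩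
  have hgm : g.Coprime m := by
    rw [← ZMod.isUnit_iff_coprime, hgu]
    exact u.isUnit
  have hγ : ZMod.unitOfCoprime g hgm = u := Units.ext hgu
  set n := Module.finrank ℚ (maximalRealSubfield F)
  have hcard : Nat.card (ZMod m)ˣ = 2 * n := by
    rw [Nat.card_eq_fintype_card, ZMod.card_units_eq_totient,
      two_mul_finrank_maximalRealSubfield (F := F) (m := m)]
  have hneg : (-1 : (ZMod m)ˣ) ≠ 1 := fun h =>
    ZMod.neg_one_ne_one (n := m) (by simpa using congrArg Units.val h)
  have hun := pow_half_order_eq_neg_one hneg hu hcard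
  refine exists_unit_norm_eq_neg_one_of_generator hζ (by omega) hg hgm (fun a => ?_)
    (halfSine_of_two_mul_dvd hζ (by omega) ?_)
  · obtain ⟨j, hj⟩ := (mem_powers_iff_mem_zpowers (x := u)).2 (hu a)
    exact ⟨j, Or.inl (by rw [hγ, ← hj])⟩
  · refine Nat.Coprime.mul_dvd_of_dvd_of_dvd hodd.coprime_two_left ?_ ?_
    · exact even_iff_two_dvd.1 (hg.pow.add_odd odd_one)
    · rw [← ZMod.natCast_eq_zero_iff]
      have h1 := congrArg Units.val hun
      rw [Units.val_pow_eq_pow_val, Units.val_neg, Units.val_one, ← hgu] at h1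
      push_cast
      rw [h1, neg_add_cancel]

/-- The units modulo 2^(j+2) are ±⟨5⟩, where -1 is excluded from ⟨5⟩ modulo 4. The order of 5 modulo
the next power of two shows that 5^(2^j) - 1 is an odd multiple of 2^(j+2), so the sign comes from
half a period. -/
theorem exists_unit_norm_eq_neg_one_of_two_pow {j : ℕ}
    [IsCyclotomicExtension {2 ^ (j + 2)} ℚ F] :
    ∃ κ : (𝓞 (maximalRealSubfield F))ˣ,
      Algebra.norm ℚ (κ : maximalRealSubfield F) = -1 := by
  have hζ := IsCyclotomicExtension.zeta_spec (2 ^ (j + 2)) ℚ F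
  set ζ := IsCyclotomicExtension.zeta (2 ^ (j + 2)) ℚ F
  have hcop : ∀ i : ℕ, Nat.Coprime 5 (2 ^ i) := fun i => Nat.Coprime.pow_right i (by norm_num)
  have htot : ∀ i : ℕ, (2 ^ (i + 1)).totient = 2 ^ i := fun i => by
    rw [Nat.totient_prime_pow_succ Nat.prime_two]; simp
  have hn : Module.finrank ℚ (maximalRealSubfield F) = 2 ^ j := by
    have := two_mul_finrank_maximalRealSubfield (F := F) (m := 2 ^ (j + 2))
    rw [htot, pow_succ] at this
    omega
  let γ := ZMod.unitOfCoprime 5 (hcop (j + 2))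
  have hγ : orderOf γ = 2 ^ j := by
    rw [← orderOf_units, ZMod.coe_unitOfCoprime]
    exact_mod_cast ZMod.orderOf_five j
  have h4 : 4 ∣ 2 ^ (j + 2) := ⟨2 ^ j, by ring⟩
  have hneg : (-1 : (ZMod (2 ^ (j + 2)))ˣ) ∉ Subgroup.zpowers γ := by
    rintro ⟨i, hi⟩
    have h1 := congrArg (ZMod.unitsMap h4) (show γ ^ i = -1 from hi)
    have h2 : ZMod.unitsMap h4 γ = 1 := by
      ext1
      rw [ZMod.unitsMap_val, ZMod.coe_unitOfCoprime]
      simp only [Nat.cast_ofNat, Units.val_one]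
      rw [show (5 : ZMod (2 ^ (j + 2))) = ((5 : ℕ) : ZMod (2 ^ (j + 2))) by norm_num,
        ZMod.cast_natCast h4]
      decide
    rw [map_zpow, h2, one_zpow] at h1
    have h3 := congrArg Units.val h1
    rw [ZMod.unitsMap_val, Units.val_neg, Units.val_one, Units.val_one, ZMod.cast_neg h4,
      ZMod.cast_one h4] at h3
    exact absurd h3 (by decide)
  have hidx : (Subgroup.zpowers γ).index = 2 := by
    have h1 := (Subgroup.zpowers γ).card_mul_index
    rw [Nat.card_zpowers, hγ, Nat.card_eq_fintype_card, ZMod.card_units_eq_totient, htot] at h1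
    exact Nat.eq_of_mul_eq_mul_left (by positivity) (h1.trans (pow_succ 2 j))
  refine exists_unit_norm_eq_neg_one_of_generator hζ (Nat.one_lt_two_pow (by omega)) (g := 5)
    (by decide) (hcop _) (fun a => ?_) ?_
  · have h1 : a ∈ Subgroup.zpowers γ ∨ -a ∈ Subgroup.zpowers γ := by
      by_contra! h
      have h2 := (Subgroup.mul_mem_iff_of_index_two hidx (a := -1) (b := a)).2
        (iff_of_false hneg h.1)
      rw [neg_one_mul] at h2
      exact h.2 h2
    rcases h1 with h | h
    · obtain ⟨i, hi⟩ := (mem_powers_iff_mem_zpowers (x := γ)).2 h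
      exact ⟨i, Or.inl hi.symm⟩
    · obtain ⟨i, hi⟩ := (mem_powers_iff_mem_zpowers (x := γ)).2 h
      exact ⟨i, Or.inr (by rw [← neg_neg a, ← hi])⟩
  · rw [hn]
    have hdvd : ∀ i l : ℕ, 2 ^ (i + 2) ∣ 5 ^ l - 1 ↔ 2 ^ i ∣ l := fun i l => by
      rw [← ZMod.orderOf_five i, orderOf_dvd_iff_pow_eq_one, ← ZMod.natCast_eq_zero_iff,
        Nat.cast_sub (Nat.one_le_pow _ _ (by norm_num)), sub_eq_zero]
      push_cast
      rfl
    obtain ⟨t, ht⟩ := (hdvd j (2 ^ j)).2 dvd_rfl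
    have ht' : Odd t := by
      rw [← Nat.not_even_iff_odd]
      rintro ⟨s, rfl⟩
      have := (hdvd (j + 1) (2 ^ j)).1 ⟨s, by rw [ht]; ring⟩
      exact absurd (Nat.le_of_dvd (by positivity) this) (by
        rw [pow_succ]; have : 0 < 2 ^ j := by positivity
        omega)
    obtain ⟨s, rfl⟩ := ht'
    refine halfSine_of_eq_add (m := 2 ^ (j + 1)) (s := s) (by rwa [← pow_succ']) (by positivity) ?_
    have h5 : 1 ≤ 5 ^ 2 ^ j := Nat.one_le_pow _ _ (by norm_num)
    have h6 : 5 ^ 2 ^ j = 1 + 2 ^ (j + 2) * (2 * s + 1) := by omega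
    rw [h6]
    ring

/-- The real subfield of a cyclotomic field of prime power conductor has a unit of norm `-1`. -/
theorem exists_unit_norm_eq_neg_one {p k : ℕ} (hp : p.Prime) (hm : 2 < p ^ k)
    [IsCyclotomicExtension {p ^ k} ℚ F] :
    ∃ κ : (𝓞 (maximalRealSubfield F))ˣ,
      Algebra.norm ℚ (κ : maximalRealSubfield F) = -1 := by
  rcases hp.eq_two_or_odd' with rfl | hodd
  · obtain ⟨j, rfl⟩ : ∃ j, k = j + 2 := by
      refine ⟨k - 2, ?_⟩
      have : 1 < k := (Nat.pow_lt_pow_iff_right one_lt_two).1 (by simpa using hm)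
      omega
    exact exists_unit_norm_eq_neg_one_of_two_pow (F := F) (j := j)
  · exact exists_unit_norm_eq_neg_one_of_odd (m := p ^ k) hm hodd.pow
      (ZMod.isCyclic_units_of_prime_pow p hp (by rintro rfl; exact absurd hodd (by decide)) k)

end Cyclotomic

/-! ### The inverse different of a cyclotomic field -/

section Different

open Polynomial
open scoped Pointwise

variable {F : Type*} [Field F] {ζ : F} {m : ℕ}

theorem prod_primitiveRoots_eq_one (hζ : IsPrimitiveRoot ζ m) (hm : 2 < m) :
    ∏ μ ∈ primitiveRoots m F, μ = 1 := by
  have h := cyclotomic_coeff_zero F (n := m) (by omega)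
  rw [coeff_zero_eq_eval_zero, cyclotomic_eq_prod_X_sub_primitiveRoots hζ, eval_prod] at h
  simp only [eval_sub, eval_X, eval_C, zero_sub] at h
  rwa [Finset.prod_neg, hζ.card_primitiveRoots, (Nat.totient_even hm).neg_one_pow, one_mul] at h

theorem aeval_derivative_minpoly_eq_prod [CharZero F] [DecidableEq F] (hζ : IsPrimitiveRoot ζ m)
    (hm : 0 < m) : aeval ζ (derivative (minpoly ℚ ζ)) =
      ∏ μ ∈ (primitiveRoots m F).erase ζ, (ζ - μ) := by
  have hmem : ζ ∈ primitiveRoots m F := (mem_primitiveRoots hm).2 hζ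
  rw [← cyclotomic_eq_minpoly_rat hζ hm, aeval_def, ← eval_map, ← derivative_map, map_cyclotomic,
    cyclotomic_eq_prod_X_sub_primitiveRoots hζ, ← Finset.mul_prod_erase _ _ hmem, derivative_mul]
  simp [eval_prod]

variable [NumberField F]

/-- Conjugation sends ζ - μ to -ζ⁻¹μ⁻¹(ζ - μ). There are φ(m) - 1 = 2r + 1 factors, and the μ⁻¹
multiply to ζ, which makes the exponent of ζ⁻¹ even; ζ^r can then absorb half of it. -/
theorem complexConj_aeval_derivative_minpoly [IsCMField F] (hζ : IsPrimitiveRoot ζ m)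
    (hm : 2 < m) : ∃ r : ℕ, IsCMField.complexConj F (aeval ζ (derivative (minpoly ℚ ζ))) =
      -(ζ⁻¹ ^ (2 * r) * aeval ζ (derivative (minpoly ℚ ζ))) := by
  classical
  have hm0 : 0 < m := by omega
  have hmem : ζ ∈ primitiveRoots m F := (mem_primitiveRoots hm0).2 hζ
  have hζ0 : ζ ≠ 0 := hζ.ne_zero hm0.ne'
  have hcard : ((primitiveRoots m F).erase ζ).card + 1 = m.totient := by
    rw [Finset.card_erase_add_one hmem, hζ.card_primitiveRoots]
  obtain ⟨l, hl⟩ := Nat.totient_even hm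
  obtain ⟨r, hr⟩ : ∃ r, ((primitiveRoots m F).erase ζ).card = 2 * r + 1 := ⟨l - 1, by omega⟩
  have hprod : ∏ μ ∈ (primitiveRoots m F).erase ζ, μ⁻¹ = ζ := by
    have h := prod_primitiveRoots_eq_one hζ hm
    rw [← Finset.mul_prod_erase _ _ hmem] at h
    rw [Finset.prod_inv_distrib]
    exact inv_eq_of_mul_eq_one_left h
  refine ⟨r, ?_⟩
  rw [aeval_derivative_minpoly_eq_prod hζ hm0, map_prod]
  have h1 : ∀ μ ∈ (primitiveRoots m F).erase ζ,
      IsCMField.complexConj F (ζ - μ) = -ζ⁻¹ * (ζ - μ) * μ⁻¹ := by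
    intro μ hμ
    have hμ' := (mem_primitiveRoots hm0).1 (Finset.mem_of_mem_erase hμ)
    have hμ0 : μ ≠ 0 := hμ'.ne_zero hm0.ne'
    rw [map_sub, complexConj_of_pow_eq_one hm0.ne' hζ.pow_eq_one,
      complexConj_of_pow_eq_one hm0.ne' hμ'.pow_eq_one]
    field_simp
    ring
  rw [Finset.prod_congr rfl h1, Finset.prod_mul_distrib, Finset.prod_mul_distrib, hprod,
    Finset.prod_const, hr, pow_succ, (even_two_mul r).neg_pow]
  field_simp

theorem aeval_derivative_minpoly_ne_zero (hζ : IsPrimitiveRoot ζ m) (hm : 0 < m) :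
    aeval ζ (derivative (minpoly ℚ ζ)) ≠ 0 := by
  classical
  rw [aeval_derivative_minpoly_eq_prod hζ hm, Finset.prod_ne_zero_iff]
  exact fun μ hμ => sub_ne_zero.2 (Finset.ne_of_mem_erase hμ).symm

/-- The trace dual of the ring of integers of a cyclotomic field. -/
theorem isIntegral_iff_forall_trace [NeZero m] [IsCyclotomicExtension {m} ℚ F]
    (hζ : IsPrimitiveRoot ζ m) (a : (𝓞 F)ˣ) (x : F) :
    IsIntegral ℤ x ↔ ∀ y : 𝓞 F, ∃ k : ℤ, Algebra.trace ℚ F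
      (a * (aeval ζ (derivative (minpoly ℚ ζ)))⁻¹ * x * y) = k := by
  have hint : ∀ z : F, IsIntegral ℤ z ↔ z ∈ Algebra.adjoin ℤ {ζ} := fun z => by
    have := IsCyclotomicExtension.Rat.isIntegralClosure_adjoin_singleton hζ
    rw [IsIntegralClosure.isIntegral_iff (A := Algebra.adjoin ℤ {ζ})]
    simp
  have hD := aeval_derivative_minpoly_ne_zero hζ (NeZero.pos m)
  -- Euler's formula: the trace dual of ℤ[ζ] is f'(ζ)⁻¹ ℤ[ζ], with f the minimal polynomial of ζ.
  have hdual := traceForm_dualSubmodule_adjoin ℤ ℚ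
    (IsCyclotomicExtension.adjoin_primitive_root_eq_top (A := ℚ) hζ)
    (hζ.isIntegral (NeZero.pos m))
  set D := aeval ζ (derivative (minpoly ℚ ζ))
  have h1 : IsIntegral ℤ x ↔ IsIntegral ℤ (a * x) := by
    refine ⟨fun h => a.val.2.mul h, fun h => ?_⟩
    have h2 := (a⁻¹ : (𝓞 F)ˣ).val.2.mul h
    have h3 : ((a⁻¹ : (𝓞 F)ˣ) : F) * (a : F) = 1 := by
      rw [← map_mul]; simp
    change IsIntegral ℤ (((a⁻¹ : (𝓞 F)ˣ) : F) * (a * x)) at h2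
    rwa [← mul_assoc, h3, one_mul] at h2
  have h2 := SetLike.ext_iff.1 hdual (a * D⁻¹ * x)
  rw [Submodule.mem_smul_pointwise_iff_exists] at h2
  rw [h1, hint]
  refine Iff.trans ?_ (h2.symm.trans ?_)
  · constructor
    · exact fun h => ⟨_, h, by rw [smul_eq_mul]; ring⟩
    · rintro ⟨z, hz, h⟩
      have : z = a * x := by
        rw [smul_eq_mul] at h
        field_simp at h
        exact h
      rwa [← this]
  · rw [LinearMap.BilinForm.mem_dualSubmodule]
    constructor
    · intro h y
      obtain ⟨k, hk⟩ := Submodule.mem_one.1 (h y ((hint _).1 y.2))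
      exact ⟨k, hk.symm⟩
    · intro h y hy
      obtain ⟨k, hk⟩ := h ⟨y, (hint y).2 hy⟩
      exact Submodule.mem_one.2 ⟨k, hk.symm⟩

end Different

/-! ### Existence of a principal polarization -/

section Existence

variable {F : Type*} [Field F] [NumberField F] [IsCMField F]

omit [IsCMField F] in
theorem exists_ofReal_eq_comp (φ : F →+* ℂ) : ∃ τ : maximalRealSubfield F →+* ℝ,
    φ.comp (algebraMap (maximalRealSubfield F) F) = Complex.ofRealHom.comp τ := by
  have h : ComplexEmbedding.IsReal (φ.comp (algebraMap (maximalRealSubfield F) F)) :=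
    IsTotallyReal.complexEmbedding_isReal _
  exact ⟨h.embedding, by ext x; exact (h.coe_embedding_apply x).symm⟩

theorem CMType.eq_of_comp_eq (Φ : CMType F) {φ ψ : F →+* ℂ} (hφ : φ ∈ Φ.embeddings)
    (hψ : ψ ∈ Φ.embeddings) (h : φ.comp (algebraMap (maximalRealSubfield F) F) =
      ψ.comp (algebraMap (maximalRealSubfield F) F)) : φ = ψ := by
  have h1 : InfinitePlace.mk φ = InfinitePlace.mk ψ := by
    apply (IsCMField.equivInfinitePlace F).injective
    rw [IsCMField.equivInfinitePlace_apply, IsCMField.equivInfinitePlace_apply,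
      InfinitePlace.comap_mk, InfinitePlace.comap_mk, h]
  rcases InfinitePlace.mk_eq_iff.1 h1 with h2 | h2
  · exact h2
  · exact absurd (h2 ▸ hψ) (Φ.conjugate_notMem φ hφ)

/-- The element δ = ζ^r/f'(ζ) generates the trace dual and is purely imaginary. A real unit u,
negative at the places where Im φ(δ) > 0 for the φ in Φ above, puts uδ on the negative imaginary
axis. -/
theorem CMType.exists_isPrincipal (Φ : CMType F)
    (h : unitsMulTotallyPositive (maximalRealSubfield F) = ⊤) {m : ℕ} (hm : 2 < m)
    [IsCyclotomicExtension {m} ℚ F] : ∃ ξ, Φ.IsPrincipal ξ := by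
  have : NeZero m := NeZero.of_gt hm
  have hζ := IsCyclotomicExtension.zeta_spec m ℚ F
  set ζ := IsCyclotomicExtension.zeta m ℚ F
  obtain ⟨r, hr⟩ := complexConj_aeval_derivative_minpoly hζ hm
  have hD := aeval_derivative_minpoly_ne_zero hζ (NeZero.pos m)
  have hint := isIntegral_iff_forall_trace hζ
  set D := Polynomial.aeval ζ (Polynomial.derivative (minpoly ℚ ζ))
  have hζ0 : ζ ≠ 0 := hζ.ne_zero (NeZero.ne m)
  set δ := ζ ^ r * D⁻¹
  have hδ0 : δ ≠ 0 := mul_ne_zero (pow_ne_zero _ hζ0) (inv_ne_zero hD)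
  have hδ : IsCMField.complexConj F δ = -δ := by
    rw [map_mul, map_pow, map_inv₀, hr, complexConj_of_pow_eq_one (NeZero.ne m) hζ.pow_eq_one]
    simp only [δ, inv_pow, two_mul, pow_add]
    field_simp
  have hre : ∀ φ : F →+* ℂ, (φ δ).re = 0 := fun φ => by
    have h1 := congrArg Complex.re (IsCMField.complexEmbedding_complexConj F φ δ)
    rw [hδ, map_neg, Complex.neg_re, Complex.conj_re] at h1
    linarith
  have him : ∀ φ : F →+* ℂ, (φ δ).im ≠ 0 := fun φ h1 =>
    hδ0 (φ.injective (by rw [map_zero]; exact Complex.ext (hre φ) h1))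
  obtain ⟨u, hu⟩ := exists_unit_sign h {τ | ∃ φ ∈ Φ.embeddings, 0 < (φ δ).im ∧
    φ.comp (algebraMap (maximalRealSubfield F) F) = Complex.ofRealHom.comp τ}
  have hval : ∀ (φ : F →+* ℂ) (τ : maximalRealSubfield F →+* ℝ),
      φ.comp (algebraMap (maximalRealSubfield F) F) = Complex.ofRealHom.comp τ →
      φ (((u : maximalRealSubfield F) : F) * δ) = (τ u : ℝ) * φ δ := fun φ τ hφ => by
    rw [map_mul, ofReal_eq_of_comp_eq hφ]
  refine ⟨((u : maximalRealSubfield F) : F) * δ, ?_, ?_, ?_⟩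
  · intro φ _
    obtain ⟨τ, hτ⟩ := exists_ofReal_eq_comp φ
    rw [hval φ τ hτ, Complex.re_ofReal_mul, hre, mul_zero]
  · intro φ hφ
    obtain ⟨τ, hτ⟩ := exists_ofReal_eq_comp φ
    rw [hval φ τ hτ, Complex.im_ofReal_mul]
    rcases (him φ).lt_or_gt with h1 | h1
    · refine mul_neg_of_pos_of_neg ((hu τ).2 ?_) h1
      rintro ⟨ψ, hψ, h2, h3⟩
      rw [Φ.eq_of_comp_eq hψ hφ (h3.trans hτ.symm)] at h2
      exact absurd h2 h1.not_gt
    · exact mul_neg_of_neg_of_pos ((hu τ).1 ⟨φ, hφ, h1, hτ⟩) h1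
  · let a : (𝓞 F)ˣ := Units.map (algebraMap (𝓞 (maximalRealSubfield F)) (𝓞 F)) u *
      (hζ.toInteger_isPrimitiveRoot.isUnit (NeZero.ne m)).unit ^ r
    have ha : (a : F) = ((u : maximalRealSubfield F) : F) * ζ ^ r := by
      simp [a]
      rfl
    intro x
    rw [hint a x, ha]
    simp only [δ, mul_assoc]

end Existence

/-! ### Uniqueness: totally positive units as norms -/

section Uniqueness

variable {F : Type*} [Field F] [NumberField F] [IsCMField F]

omit [IsCMField F] in
theorem CMType.IsPrincipal.isIntegral_div {Φ : CMType F} {ξ ξ' : F} (h : Φ.IsPrincipal ξ)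
    (h' : Φ.IsPrincipal ξ') : IsIntegral ℤ (ξ / ξ') := by
  rw [h'.isIntegral_iff, mul_div_cancel₀ _ h'.ne_zero]
  simpa using (h.isIntegral_iff 1).1 isIntegral_one

theorem CMType.IsPrincipal.complexConj_eq_neg {Φ : CMType F} {ξ : F} (h : Φ.IsPrincipal ξ) :
    IsCMField.complexConj F ξ = -ξ := by
  obtain ⟨φ, hφ⟩ := Φ.nonempty
  apply φ.injective
  rw [IsCMField.complexEmbedding_complexConj, map_neg]
  apply Complex.ext <;> simp [h.re_eq_zero φ hφ]

/-- Two principal elements differ by a totally positive unit of the real subfield. -/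
theorem CMType.IsPrincipal.exists_eq_mul {Φ : CMType F} {ξ ξ' : F} (h : Φ.IsPrincipal ξ)
    (h' : Φ.IsPrincipal ξ') : ∃ v : (𝓞 (maximalRealSubfield F))ˣ,
      (∀ τ : maximalRealSubfield F →+* ℝ, 0 < τ v) ∧
      ξ = ξ' * ((v : maximalRealSubfield F) : F) := by
  let ε : (𝓞 F)ˣ :=
    ⟨⟨ξ / ξ', h.isIntegral_div h'⟩, ⟨ξ' / ξ, h'.isIntegral_div h⟩,
      RingOfIntegers.ext (div_mul_div_cancel₀' h.ne_zero ξ' ξ' |>.trans (div_self h'.ne_zero)),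
      RingOfIntegers.ext (div_mul_div_cancel₀' h'.ne_zero ξ ξ |>.trans (div_self h.ne_zero))⟩
  have hε : (ε : F) = ξ / ξ' := rfl
  obtain ⟨v, hv⟩ := (IsCMField.Units.complexConj_eq_self_iff F ε).1 (by
    rw [hε, map_div₀, h.complexConj_eq_neg, h'.complexConj_eq_neg, neg_div_neg_eq])
  have hv' : ((v : maximalRealSubfield F) : F) = ξ / ξ' := hv
  have hξ : ξ = ξ' * ((v : maximalRealSubfield F) : F) := by
    rw [hv', mul_div_cancel₀ _ h'.ne_zero]
  refine ⟨v, fun τ => ?_, hξ⟩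
  -- Of the two conjugate extensions of τ to F, one lies in Φ; there φ(ξ) and φ(ξ') are both
  -- negative imaginary, so their ratio τ(v) is positive.
  obtain ⟨φ, hφ, hτ⟩ : ∃ φ ∈ Φ.embeddings,
      φ.comp (algebraMap (maximalRealSubfield F) F) = Complex.ofRealHom.comp τ := by
    obtain ⟨φ, hφ⟩ := exists_comp_eq_ofReal τ
    rcases Φ.mem_or_conjugate_mem φ with h1 | h1
    · exact ⟨φ, h1, hφ⟩
    · refine ⟨_, h1, ?_⟩
      ext x
      have h2 := RingHom.congr_fun hφ x
      simp only [RingHom.comp_apply] at h2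
      simp [ComplexEmbedding.conjugate_coe_eq, h2]
  have h1 := congrArg (fun x => (φ x).im) hξ
  simp only [map_mul, ← ofReal_eq_of_comp_eq hτ, Complex.im_mul_ofReal] at h1
  have h2 := h.im_neg φ hφ
  have h3 := h'.im_neg φ hφ
  rw [h1] at h2
  exact (pos_iff_pos_of_mul_pos (by nlinarith : 0 < -(φ ξ').im * τ v)).1 (by linarith)

theorem CMType.IsSimple.isIsomorphic {Φ : CMType F} [IsAbelianGalois ℚ F] (hΦ : Φ.IsSimple)
    (hF : classNumber F = 1)
    (hN : ∀ v : (𝓞 (maximalRealSubfield F))ˣ, (∀ τ : maximalRealSubfield F →+* ℝ, 0 < τ v) →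
      ∃ u : (𝓞 F)ˣ, ((v : maximalRealSubfield F) : F) = u * IsCMField.complexConj F u)
    {A B : PPAV} (hA : A.HasType Φ) (hB : B.HasType Φ) : A.IsIsomorphic B := by
  obtain ⟨ξ, hξ⟩ := hΦ.exists_isNormalForm hF hA
  obtain ⟨ξ', hξ'⟩ := hΦ.exists_isNormalForm hF hB
  obtain ⟨v, hv, hvξ⟩ := hξ.isPrincipal.exists_eq_mul hξ'.isPrincipal
  obtain ⟨u, hu⟩ := hN v hv
  exact hξ.isIsomorphic hξ' u (hu ▸ hvξ)

theorem eq_mul_complexConj_of_eq_mul_sq {v t : (𝓞 (maximalRealSubfield F))ˣ} {w : (𝓞 F)ˣ}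
    (h : ((v : maximalRealSubfield F) : F) =
      w * IsCMField.complexConj F w * ((t : maximalRealSubfield F) : F) ^ 2) :
    ∃ u : (𝓞 F)ˣ, ((v : maximalRealSubfield F) : F) = u * IsCMField.complexConj F u := by
  let u : (𝓞 F)ˣ := w * Units.map (algebraMap (𝓞 (maximalRealSubfield F)) (𝓞 F)) t
  have hu : (u : F) = w * ((t : maximalRealSubfield F) : F) := rfl
  have ht : IsCMField.complexConj F ((t : maximalRealSubfield F) : F) =
      ((t : maximalRealSubfield F) : F) :=
    (IsCMField.complexConj_eq_self_iff F _).2 (t : maximalRealSubfield F).2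
  refine ⟨u, ?_⟩
  rw [h, hu, map_mul, ht]
  ring

theorem exists_eq_mul_complexConj_of_eq_top
    (h : unitsMulTotallyPositive (maximalRealSubfield F) = ⊤)
    (v : (𝓞 (maximalRealSubfield F))ˣ) (hv : ∀ τ : maximalRealSubfield F →+* ℝ, 0 < τ v) :
    ∃ u : (𝓞 F)ˣ, ((v : maximalRealSubfield F) : F) = u * IsCMField.complexConj F u := by
  obtain ⟨t, ht⟩ := exists_eq_sq_of_eq_top h v hv
  refine eq_mul_complexConj_of_eq_mul_sq (t := t) (w := 1) ?_
  rw [ht]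
  simp

theorem exists_eq_mul_complexConj_of_index_eq_two
    (h : (unitsMulTotallyPositive (maximalRealSubfield F)).index = 2) {m : ℕ} (hm : 2 < m)
    [IsCyclotomicExtension {m} ℚ F]
    (v : (𝓞 (maximalRealSubfield F))ˣ) (hv : ∀ τ : maximalRealSubfield F →+* ℝ, 0 < τ v) :
    ∃ u : (𝓞 F)ˣ, ((v : maximalRealSubfield F) : F) = u * IsCMField.complexConj F u := by
  -- For m ≡ 2 mod 4 the field is also the (m/2)-th cyclotomic field. The reduction matters: for
  -- such m, -ζ is a square in F.
  wlog hm4 : Odd m ∨ 4 ∣ m generalizing m with H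
  · push Not at hm4
    obtain ⟨k, rfl⟩ := even_iff_two_dvd.1 (Nat.not_odd_iff_even.1 hm4.1)
    have hk : Odd k := by
      rw [← Nat.not_even_iff_odd]
      rintro ⟨l, rfl⟩
      exact hm4.2 ⟨l, by ring⟩
    have := isCyclotomicExtension_of_two_mul_odd (F := F) hk
    obtain ⟨l, rfl⟩ := hk
    exact H (m := 2 * l + 1) (by omega) (Or.inl ⟨l, rfl⟩)
  have : NeZero m := NeZero.of_gt hm
  have : IsAbelianGalois ℚ F := IsCyclotomicExtension.isAbelianGalois {m} ℚ F
  have : IsAbelianGalois ℚ (maximalRealSubfield F) :=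
    IsAbelianGalois.tower_bot ℚ (maximalRealSubfield F) F
  obtain ⟨w, x, hx, hx'⟩ := exists_nonsquare_norm (F := F) hm hm4 fun {p} hp k hk => by
    subst hk
    obtain ⟨κ, hκ⟩ := exists_unit_norm_eq_neg_one (F := F) hp hm
    exact index_ne_two_of_norm_eq_neg_one κ hκ h
  have hw : (w : F) ≠ 0 := by simp
  obtain ⟨t, ht | ht⟩ := exists_eq_mul_sq_of_index_eq_two h v x hv
    (pos_of_coe_eq_mul_complexConj hw hx) hx'
  · refine eq_mul_complexConj_of_eq_mul_sq (t := t) (w := 1) ?_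
    rw [ht]
    simp
  · refine eq_mul_complexConj_of_eq_mul_sq (t := t) (w := w) ?_
    rw [ht, ← hx]
    rfl

end Uniqueness

end CMAbelian

theorem mainTheorem5 (m : ℕ) (hm : 2 < m) (F : Type*) [Field F] [NumberField F]
    [IsCyclotomicExtension {m} ℚ F] (hF : NumberField.classNumber F = 1)
    (Φ : CMAbelian.CMType F) :
    (CMAbelian.narrowClassNumber (NumberField.maximalRealSubfield F) = 1 →
      (∃ A : CMAbelian.PPAV, A.HasType Φ) ∧
      (Φ.IsSimple → ∀ A B : CMAbelian.PPAV, A.HasType Φ → B.HasType Φ → A.IsIsomorphic B)) ∧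
    (CMAbelian.narrowClassNumber (NumberField.maximalRealSubfield F) = 2 → Φ.IsSimple →
      ∀ A B : CMAbelian.PPAV, A.HasType Φ → B.HasType Φ → A.IsIsomorphic B) := by
  have : NeZero m := NeZero.of_gt hm
  have : IsCMField F := IsCyclotomicExtension.Rat.isCMField F (S := {m}) ⟨m, rfl, hm⟩
  have : IsAbelianGalois ℚ F := IsCyclotomicExtension.isAbelianGalois {m} ℚ F
  have hdvd := CMAbelian.index_unitsMulTotallyPositive_dvd (K := maximalRealSubfield F)
  refine ⟨fun h => ?_, fun h hΦ A B => ?_⟩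
  · rw [h, Nat.dvd_one, Subgroup.index_eq_one] at hdvd
    obtain ⟨ξ, hξ⟩ := Φ.exists_isPrincipal hdvd hm
    exact ⟨hξ.exists_hasType, fun hΦ A B =>
      hΦ.isIsomorphic hF (CMAbelian.exists_eq_mul_complexConj_of_eq_top hdvd)⟩
  -- Narrow class number 2 only bounds the index of UP, so index 1 has to be treated here as well.
  · rw [h, Nat.dvd_prime Nat.prime_two, Subgroup.index_eq_one] at hdvd
    rcases hdvd with h1 | h2
    · exact hΦ.isIsomorphic hF (CMAbelian.exists_eq_mul_complexConj_of_eq_top h1)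
    · exact hΦ.isIsomorphic hF (CMAbelian.exists_eq_mul_complexConj_of_index_eq_two h2 hm)
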